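/- Let $d\in\mathbb N$ and $0<s<\min\{1,d/2\}$. Write $\hat u(\xi)=(2\pi)^{-d/2}\int_{\mathbb R^d}u(x)e^{-i\xi\cdot x}\,dx$, $$\mathcal C_{s,d}=2^{2s}\,\frac{\Gamma((d+2s)/4)^2}{\Gamma((d-2s)/4)^2},\qquad a_{s,d}=2^{2s-1}\pi^{-d/2}\,\frac{\Gamma((d+2s)/2)}{|\Gamma(-s)|},$$ and $$h_s[u]=\int_{\mathbb R^d}|\xi|^{2s}|\hat u(\xi)|^2\,d\xi-\mathcal C_{s,d}\int_{\mathbb R^d}|x|^{-2s}|u(x)|^2\,dx .$$ All functions are complex valued. 1. (Ground state representation.) If $u\in C_0^\infty(\mathbb R^d\setminus\{0\})$ and $v(x)=|x|^{(d-2s)/2}u(x)$, then $$h_s[u]=a_{s,d}\int_{\mathbb R^d}\int_{\mathbb R^d}\frac{|v(x)-v(y)|^2}{|x-y|^{d+2s}}\,\frac{dx}{|x|^{(d-2s)/2}}\,\frac{dy}{|y|^{(d-2s)/2}},$$ where all the integrals converge absolutely. 2. (Hardy inequality.) For every $u\in C_0^\infty(\mathbb R^d)$ both integrals below are finite and $$\int_{\mathbb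 R^d}|x|^{-2s}|u(x)|^2\,dx\le \mathcal C_{s,d}^{-1}\int_{\mathbb R^d}|\xi|^{2s}|\hat u(\xi)|^2\,d\xi .$$ 3. (Sharpness.) If $K\in\mathbb R$ is such that the inequality in 2 holds for all $u\in C_0^\infty(\mathbb R^d)$ with $K$ in place of $\mathcal C_{s,d}^{-1}$, then $K\ge\mathcal C_{s,d}^{-1}$. 4. (Equality is not attained.) Let $u$ be a measurable function on $\mathbb R^d$, not a.e. zero, which defines a tempered distribution whose Fourier transform $\hat u$ is a function, and suppose that $\int|x|^{-2s}|u(x)|^2\,dx<\infty$ and $\int|\xi|^{2s}|\hat u(\xi)|^2\,d\xi<\infty$. Then $$\int_{\mathbb R^d}|x|^{-2s}|u(x)|^2\,dx<\mathcal C_{s,d}^{-1}\int_{\mathbb R^d}|\xi|^{2s}|\hat u(\xi)|^2\,d\xi .$$ -/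

import Mathlib

open MeasureTheory
open scoped ContDiff SchwartzMap

namespace FracHardy

noncomputable section

/-- The Fourier transform with the unitary normalization,
`û(ξ) = (2π)^(-d/2) ∫ u(x) e^(-i ξ·x) dx`. -/
def fourierHat {d : ℕ} (u : EuclideanSpace ℝ (Fin d) → ℂ) (ξ : EuclideanSpace ℝ (Fin d)) : ℂ :=
  (((2 * Real.pi) ^ (-(d : ℝ) / 2) : ℝ) : ℂ) *
    ∫ x, u x * Complex.exp (-(Complex.I * ((inner ℝ ξ x : ℝ) : ℂ)))

/-- The sharp Hardy constant `2^(2s) Γ((d+2s)/4)² / Γ((d-2s)/4)²`. -/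
def hardyConst (s : ℝ) (d : ℕ) : ℝ :=
  2 ^ (2 * s) * (Real.Gamma ((d + 2 * s) / 4) ^ 2 / Real.Gamma ((d - 2 * s) / 4) ^ 2)

/-- The constant `a_{s,d} = 2^(2s-1) π^(-d/2) Γ((d+2s)/2) / |Γ(-s)|`. -/
def formConst (s : ℝ) (d : ℕ) : ℝ :=
  2 ^ (2 * s - 1) * Real.pi ^ (-(d : ℝ) / 2) *
    (Real.Gamma ((d + 2 * s) / 2) / |Real.Gamma (-s)|)

/-- The density `|ξ|^(2s) |w(ξ)|²`; used with `w = û`. -/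
def kineticDensity {d : ℕ} (s : ℝ) (w : EuclideanSpace ℝ (Fin d) → ℂ)
    (ξ : EuclideanSpace ℝ (Fin d)) : ℝ :=
  ‖ξ‖ ^ (2 * s) * ‖w ξ‖ ^ 2

/-- The density `|x|^(-2s) |u(x)|²`. -/
def hardyDensity {d : ℕ} (s : ℝ) (u : EuclideanSpace ℝ (Fin d) → ℂ)
    (x : EuclideanSpace ℝ (Fin d)) : ℝ :=
  ‖x‖ ^ (-(2 * s)) * ‖u x‖ ^ 2

/-- The quadratic form `h_s[u] = ∫ |ξ|^(2s) |û(ξ)|² dξ - C_{s,d} ∫ |x|^(-2s) |u(x)|² dx`. -/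
def hardyForm {d : ℕ} (s : ℝ) (u : EuclideanSpace ℝ (Fin d) → ℂ) : ℝ :=
  (∫ ξ, kineticDensity s (fourierHat u) ξ) - hardyConst s d * ∫ x, hardyDensity s u x

/-- The function `v(x) = |x|^((d-2s)/2) u(x)`. -/
def groundStateQuotient {d : ℕ} (s : ℝ) (u : EuclideanSpace ℝ (Fin d) → ℂ)
    (x : EuclideanSpace ℝ (Fin d)) : ℂ :=
  ((‖x‖ ^ (((d : ℝ) - 2 * s) / 2) : ℝ) : ℂ) * u x

/-- The integrand
`|v(x) - v(y)|² / |x-y|^(d+2s) · |x|^(-(d-2s)/2) · |y|^(-(d-2s)/2)`. -/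
def groundStateKernel {d : ℕ} (s : ℝ) (v : EuclideanSpace ℝ (Fin d) → ℂ)
    (x y : EuclideanSpace ℝ (Fin d)) : ℝ :=
  ‖v x - v y‖ ^ 2 / ‖x - y‖ ^ ((d : ℝ) + 2 * s) *
    ‖x‖ ^ (-(((d : ℝ) - 2 * s) / 2)) * ‖y‖ ^ (-(((d : ℝ) - 2 * s) / 2))

/-- `u ∈ C_0^∞(ℝ^d)`, complex valued. -/
def IsTestFunction {d : ℕ} (u : EuclideanSpace ℝ (Fin d) → ℂ) : Prop :=
  ContDiff ℝ ∞ u ∧ HasCompactSupport u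

/-- `u` and `g` are functions defining tempered distributions, and `g` is the Fourier transform
of `u` in the sense of tempered distributions: `∫ u φ̂ = ∫ g φ` for all Schwartz functions `φ`. -/
def HasFourierTransform {d : ℕ} (u g : EuclideanSpace ℝ (Fin d) → ℂ) : Prop :=
  AEStronglyMeasurable u volume ∧ AEStronglyMeasurable g volume ∧
    ∀ φ : 𝓢(EuclideanSpace ℝ (Fin d), ℂ),
      Integrable (fun x => u x * fourierHat φ x) ∧ Integrable (fun ξ => g ξ * φ ξ) ∧
        ∫ x, u x * fourierHat φ x = ∫ ξ, g ξ * φ ξ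

end

end FracHardy

/-!
# Ground state representation and the sharp fractional Hardy inequality

Write `α = (d - 2 * s) / 2`, `w x = ‖x‖ ^ (-α)` (`groundState`) and `k = ‖x - y‖ ^ (-(d + 2 * s))`
(`rieszKernel`).

* *The kinetic energy is a Gagliardo seminorm.* The function `u (· + h) - u` has Fourier transform
  `(e ^ (i ξ·h) - 1) û`, so Plancherel's theorem and integration in `h` give
  `∫ ‖ξ‖ ^ (2 * s) * ‖û‖ ^ 2 = a ∬ ‖u x - u y‖ ^ 2 k`, as an identity in `[0, ∞]` which also holds
  for the tempered distributions of the equality case (`HasFourierTransform.gagliardo_eq`). The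
  constant `a` comes from `∫ (1 - cos (ξ·h)) * ‖h‖ ^ (-(d + 2 * s))`
  (`lintegral_one_sub_cos_mul_rpow`), which is evaluated by integrating it against a Gaussian.

* *Ground state substitution.* For `u = w v` and `f = ‖u‖ ^ 2 / w`,
  `‖u x - u y‖ ^ 2 = w x * w y * ‖v x - v y‖ ^ 2 + (w x - w y) * (f x - f y)`.
  The last term is first integrated over a truncated kernel whose truncation is invariant under
  dilations and rotations. By homogeneity the result is a constant multiple of
  `∫ ‖x‖ ^ (-2 * s) * ‖u‖ ^ 2`, whatever `u` is. That constant is found in the limit of vanishing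
  truncation from the one choice where `f` is a Gaussian: the energy pairing of `w` with a Gaussian
  is a Gamma integral (`groundState_gaussian_energy`). This gives
  `gagliardo_eq_groundState_add`, hence the ground state representation, without any principal
  value and without the Fourier transform of `w`.

* *Hardy inequality and strictness.* The remainder in the representation is nonnegative. If it
  vanishes, then `v` is almost everywhere constant, so that `u` is a multiple of `w`, whose Hardy
  integral diverges (`groundStateEnergy_ne_zero`).

* *Sharpness.* For the test functions `w * χ` with `χ` a smooth cut-off in the variable
  `log ‖x‖`, stretched by a factor `n`, the remainder in the representation is `o(1)` relative to
  the Hardy integral (`tendsto_lintegral_logKernel`).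
-/


namespace FracHardy

open Set Real Filter Topology FourierTransform

variable {d : ℕ}

local notation "𝔼" => EuclideanSpace ℝ (Fin d)

/-! ### Radial integrals, Gaussian moments and Gamma integrals -/

/-- The surface measure of the unit sphere of `ℝ^d`, as `d` times the volume of the unit ball. -/
noncomputable def sphereArea (d : ℕ) : ℝ :=
  d * volume.real (Metric.ball (0 : EuclideanSpace ℝ (Fin d)) 1)

/-- Integration of a radial function in polar coordinates. -/
lemma lintegral_radial [NeZero d] {f : ℝ → ENNReal} (hf : Measurable f) :
    ∫⁻ x : 𝔼, f ‖x‖ =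
      ENNReal.ofReal (sphereArea d) * ∫⁻ r in Ioi (0 : ℝ), ENNReal.ofReal (r ^ (d - 1)) * f r := by
  have hmp := (volume : Measure 𝔼).measurePreserving_homeomorphUnitSphereProd
  have h0 : ∫⁻ x : 𝔼, f ‖x‖ =
      ∫⁻ x : ({(0 : 𝔼)}ᶜ : Set 𝔼), f ‖x.1‖ ∂(volume.comap Subtype.val) := by
    rw [lintegral_subtype_comap (measurableSet_singleton (0 : 𝔼)).compl (fun x : 𝔼 => f ‖x‖),
      restrict_compl_singleton]
  have h1 := hmp.lintegral_comp (f := fun p => f p.2.1) (by fun_prop)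
  have h2 : (fun x : ({(0 : 𝔼)}ᶜ : Set 𝔼) => f ‖x.1‖) =
      fun x => f ((homeomorphUnitSphereProd 𝔼) x).2.1 := by
    funext x; simp
  rw [h0, h2, h1, lintegral_prod _ (by fun_prop)]
  simp only [lintegral_const]
  rw [Measure.toSphere_apply_univ, mul_comm]
  congr 1
  · simp only [sphereArea]
    rw [ENNReal.ofReal_mul (by positivity), ofReal_measureReal (by simp [measure_ball_lt_top.ne])]
    simp
  · rw [Measure.volumeIoiPow, lintegral_withDensity_eq_lintegral_mul _ (by fun_prop) (by fun_prop)]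
    simp only [Pi.mul_apply, finrank_euclideanSpace_fin]
    rw [lintegral_subtype_comap measurableSet_Ioi
      (fun r : ℝ => ENNReal.ofReal (r ^ (d - 1)) * f r)]

lemma sphereArea_pos [NeZero d] : 0 < sphereArea d := by
  have : 0 < (d : ℝ) := by exact_mod_cast Nat.pos_of_ne_zero (NeZero.ne d)
  refine mul_pos this ?_
  exact ENNReal.toReal_pos (Metric.measure_ball_pos _ _ one_pos).ne' measure_ball_lt_top.ne

/-- The value of the Bochner integral is positive, so it is not the junk value `0` and the
integrand is integrable; several integrability statements below are read off in this way. -/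
lemma lintegral_rpow_mul_exp_neg {a r : ℝ} (ha : 0 < a) (hr : 0 < r) :
    ∫⁻ t in Ioi (0 : ℝ), ENNReal.ofReal (t ^ (a - 1) * exp (-(r * t))) =
      ENNReal.ofReal (r ^ (-a) * Gamma a) := by
  have h := integral_rpow_mul_exp_neg_mul_Ioi ha hr
  have hpos : 0 < r ^ (-a) * Gamma a := mul_pos (by positivity) (Gamma_pos_of_pos ha)
  rw [one_div, inv_rpow hr.le, ← rpow_neg hr.le] at h
  rw [← ofReal_integral_eq_lintegral_ofReal, h]
  · by_contra hn
    rw [integral_undef hn] at h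
    exact hpos.ne h
  · refine (ae_restrict_iff' measurableSet_Ioi).2 (.of_forall fun t ht => ?_)
    have : 0 < t := ht
    positivity

lemma lintegral_rpow_norm_mul_gaussian [NeZero d] {p t : ℝ} (hp : -(d : ℝ) < p) (ht : 0 < t) :
    ∫⁻ x : 𝔼, ENNReal.ofReal (‖x‖ ^ p * exp (-(t * ‖x‖ ^ 2))) =
      ENNReal.ofReal (sphereArea d / 2 * t ^ (-((d + p) / 2)) * Gamma ((d + p) / 2)) := by
  have hd1 : 1 ≤ d := Nat.pos_of_ne_zero (NeZero.ne d)
  have hΓ : 0 < Gamma ((d + p) / 2) := Gamma_pos_of_pos (by linarith)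
  rw [lintegral_radial (f := fun r => ENNReal.ofReal (r ^ p * exp (-(t * r ^ 2)))) (by fun_prop)]
  have h := integral_rpow_mul_exp_neg_mul_rpow (p := 2) (q := d - 1 + p) (b := t)
    two_pos (by linarith) ht
  have hpos : 0 < t ^ (-(d - 1 + p + 1) / 2) * (1 / 2) * Gamma ((d - 1 + p + 1) / 2) := by
    rw [show (d : ℝ) - 1 + p + 1 = d + p by ring]
    positivity
  have h3 : ∫⁻ r in Ioi (0 : ℝ), ENNReal.ofReal (r ^ (d - 1)) *
      ENNReal.ofReal (r ^ p * exp (-(t * r ^ 2))) =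
      ∫⁻ r in Ioi (0 : ℝ), ENNReal.ofReal (r ^ ((d : ℝ) - 1 + p) * exp (-t * r ^ (2 : ℝ))) := by
    refine setLIntegral_congr_fun measurableSet_Ioi fun r hr => ?_
    have hr : 0 < r := hr
    rw [← ENNReal.ofReal_mul (by positivity), rpow_add hr, ← mul_assoc, rpow_two, neg_mul,
      ← rpow_natCast r (d - 1)]
    push_cast [hd1]
    rfl
  rw [h3, ← ofReal_integral_eq_lintegral_ofReal, h, ← ENNReal.ofReal_mul sphereArea_pos.le]
  · rw [show (d : ℝ) - 1 + p + 1 = d + p by ring, neg_div]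
    congr 1; ring
  · by_contra hn
    rw [integral_undef hn] at h
    exact hpos.ne h
  · refine (ae_restrict_iff' measurableSet_Ioi).2 (.of_forall fun t ht => ?_)
    have : 0 < t := ht
    positivity

/-- Here `1 - exp(-r²)` is written as `∫₀¹ r² exp(-t r²) dt` and the `x`-integral is done first. -/
lemma lintegral_one_sub_gaussian_mul_rpow [NeZero d] {s : ℝ} (hs0 : 0 < s) (hs1 : s < 1) :
    ∫⁻ x : 𝔼, ENNReal.ofReal ((1 - exp (-‖x‖ ^ 2)) * ‖x‖ ^ (-(d + 2 * s))) =
      ENNReal.ofReal (sphereArea d / 2 * (Gamma (1 - s) / s)) := by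
  have hΓ : 0 < Gamma (1 - s) := Gamma_pos_of_pos (by linarith)
  have hS := sphereArea_pos (d := d)
  have key : ∀ x : 𝔼, x ≠ 0 → ENNReal.ofReal ((1 - exp (-‖x‖ ^ 2)) * ‖x‖ ^ (-(d + 2 * s))) =
      ∫⁻ t in Ioc (0 : ℝ) 1,
        ENNReal.ofReal (‖x‖ ^ (2 - (d + 2 * s)) * exp (-(t * ‖x‖ ^ 2))) := by
    intro x hx
    have hx' : 0 < ‖x‖ := norm_pos_iff.2 hx
    rw [← ofReal_integral_eq_lintegral_ofReal]
    · congr 1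
      rw [← intervalIntegral.integral_of_le zero_le_one, intervalIntegral.integral_const_mul]
      have : ∫ t in (0 : ℝ)..1, exp (-(t * ‖x‖ ^ 2)) = (1 - exp (-‖x‖ ^ 2)) / ‖x‖ ^ 2 := by
        rw [intervalIntegral.integral_eq_sub_of_hasDerivAt
          (f := fun t => -(exp (-(t * ‖x‖ ^ 2)) / ‖x‖ ^ 2))]
        · simp; ring
        · intro t _
          have h1 : HasDerivAt (fun t : ℝ => -(t * ‖x‖ ^ 2)) (-(1 * ‖x‖ ^ 2)) t :=
            ((hasDerivAt_id t).mul_const _).neg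
          convert! ((h1.exp).div_const (‖x‖ ^ 2)).neg using 1
          field_simp
        · exact (by fun_prop : Continuous fun t => exp (-(t * ‖x‖ ^ 2))).intervalIntegrable _ _
      rw [this, rpow_sub hx', rpow_two, rpow_neg hx'.le]
      field_simp
    · refine Continuous.integrableOn_Ioc ?_
      fun_prop
    · exact .of_forall fun t => by positivity
  have h0 : ∀ᵐ x : 𝔼, x ≠ 0 := by simp [ae_iff]
  rw [lintegral_congr_ae (h0.mono key), lintegral_lintegral_swap (by fun_prop)]
  have h1 : ∀ t ∈ Ioc (0 : ℝ) 1, ∫⁻ x : 𝔼,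
      ENNReal.ofReal (‖x‖ ^ (2 - (d + 2 * s)) * exp (-(t * ‖x‖ ^ 2))) =
      ENNReal.ofReal (sphereArea d / 2 * Gamma (1 - s) * t ^ (s - 1)) := by
    intro t ht
    rw [lintegral_rpow_norm_mul_gaussian (by linarith) ht.1,
      show ((d : ℝ) + (2 - (d + 2 * s))) / 2 = 1 - s by ring, neg_sub]
    congr 1; ring
  rw [setLIntegral_congr_fun measurableSet_Ioc h1, ← ofReal_integral_eq_lintegral_ofReal]
  · congr 1
    rw [← intervalIntegral.integral_of_le zero_le_one, intervalIntegral.integral_const_mul,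
      integral_rpow (by left; linarith)]
    simp [hs0.ne']
    ring
  · have := (intervalIntegral.intervalIntegrable_rpow' (a := 0) (b := 1)
      (show -1 < s - 1 by linarith)).const_mul (sphereArea d / 2 * Gamma (1 - s))
    exact (intervalIntegrable_iff_integrableOn_Ioc_of_le zero_le_one).1 this
  · refine (ae_restrict_iff' measurableSet_Ioc).2 (.of_forall fun t ht => ?_)
    have : 0 < t := ht.1
    positivity

/-- The beta integral `∫₀^∞ τ^(b-1) (1+τ)^(-(b+c)) dτ = Γ(b) Γ(c) / Γ(b+c)`. -/
lemma lintegral_beta {b c : ℝ} (hb : 0 < b) (hc : 0 < c) :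
    ∫⁻ t in Ioi (0 : ℝ), ENNReal.ofReal (t ^ (b - 1) * (1 + t) ^ (-(b + c))) =
      ENNReal.ofReal (Gamma b * Gamma c / Gamma (b + c)) := by
  have hΓ : 0 < Gamma (b + c) := Gamma_pos_of_pos (by linarith)
  have hΓb : 0 < Gamma b := Gamma_pos_of_pos hb
  have key : ∀ t ∈ Ioi (0 : ℝ), ENNReal.ofReal (t ^ (b - 1) * (1 + t) ^ (-(b + c))) =
      ∫⁻ r in Ioi (0 : ℝ), ENNReal.ofReal (t ^ (b - 1) * (Gamma (b + c))⁻¹ *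
        (r ^ (b + c - 1) * exp (-((1 + t) * r)))) := by
    intro t ht
    have ht : 0 < t := ht
    have hnn : 0 ≤ t ^ (b - 1) * (Gamma (b + c))⁻¹ := by positivity
    simp_rw [ENNReal.ofReal_mul hnn]
    rw [lintegral_const_mul _ (by fun_prop), lintegral_rpow_mul_exp_neg (by linarith) (by linarith),
      ← ENNReal.ofReal_mul hnn]
    congr 1; field_simp
  have key2 : ∀ r ∈ Ioi (0 : ℝ),
      ∫⁻ t in Ioi (0 : ℝ), ENNReal.ofReal (t ^ (b - 1) * (Gamma (b + c))⁻¹ *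
        (r ^ (b + c - 1) * exp (-((1 + t) * r)))) =
      ENNReal.ofReal (Gamma b / Gamma (b + c)) * ENNReal.ofReal (r ^ (c - 1) * exp (-(1 * r))) := by
    intro r hr
    have hr : 0 < r := hr
    have hnn : 0 ≤ (Gamma (b + c))⁻¹ * r ^ (b + c - 1) * exp (-r) := by positivity
    have : ∀ t, t ^ (b - 1) * (Gamma (b + c))⁻¹ * (r ^ (b + c - 1) * exp (-((1 + t) * r))) =
        (Gamma (b + c))⁻¹ * r ^ (b + c - 1) * exp (-r) * (t ^ (b - 1) * exp (-(r * t))) := by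
      intro t
      rw [show -((1 + t) * r) = -r + -(r * t) by ring, exp_add]; ring
    simp_rw [this, ENNReal.ofReal_mul hnn]
    rw [lintegral_const_mul _ (by fun_prop), lintegral_rpow_mul_exp_neg hb hr,
      ← ENNReal.ofReal_mul hnn, ← ENNReal.ofReal_mul (by positivity)]
    congr 1
    rw [show b + c - 1 = b + (c - 1) by ring, rpow_add hr, rpow_neg hr.le]
    field_simp
  rw [setLIntegral_congr_fun measurableSet_Ioi key, lintegral_lintegral_swap (by fun_prop),
    setLIntegral_congr_fun measurableSet_Ioi key2, lintegral_const_mul _ (by fun_prop),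
    lintegral_rpow_mul_exp_neg hc one_pos, ← ENNReal.ofReal_mul (by positivity)]
  congr 1
  simp; ring

/-! ### Scaling and rotation invariance -/

lemma lintegral_comp_smul_of_pos (f : 𝔼 → ENNReal) {r : ℝ} (hr : 0 < r) :
    ∫⁻ x : 𝔼, f x = ENNReal.ofReal (r ^ (d : ℝ)) * ∫⁻ x : 𝔼, f (r • x) := by
  have h := Measure.map_addHaar_smul (volume : Measure 𝔼) hr.ne'
  have hm : MeasurableEmbedding (fun x : 𝔼 => r • x) :=
    (Homeomorph.smul (isUnit_iff_ne_zero.2 hr.ne').unit).measurableEmbedding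
  have h2 := hm.lintegral_map (μ := volume) f
  rw [h, lintegral_smul_measure] at h2
  rw [← h2, smul_eq_mul, ← mul_assoc, ← ENNReal.ofReal_mul (by positivity)]
  simp only [finrank_euclideanSpace_fin, rpow_natCast]
  rw [abs_of_pos (by positivity), mul_inv_cancel₀ (by positivity)]
  simp

/-- If `F` is invariant under rotations and homogeneous of degree `p`, then `∫ F(x, y) dy` is a
multiple of `|x|^(p+d)`. -/
lemma lintegral_of_homogeneous {F : 𝔼 → 𝔼 → ENNReal} {p : ℝ}
    (hR : ∀ (R : 𝔼 ≃ₗᵢ[ℝ] 𝔼) (x y : 𝔼), F (R x) (R y) = F x y)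
    (hs : ∀ r : ℝ, 0 < r → ∀ x y : 𝔼, F (r • x) (r • y) = ENNReal.ofReal (r ^ p) * F x y)
    {e x : 𝔼} (he : ‖e‖ = 1) (hx : x ≠ 0) :
    ∫⁻ y, F x y = ENNReal.ofReal (‖x‖ ^ (p + d)) * ∫⁻ y, F e y := by
  have hx' : 0 < ‖x‖ := norm_pos_iff.2 hx
  set v : 𝔼 := ‖x‖⁻¹ • x with hv
  have hvn : ‖e‖ = ‖v‖ := by
    rw [hv, norm_smul, norm_inv, norm_norm, inv_mul_cancel₀ hx'.ne', he]
  have hxv : x = ‖x‖ • v := by rw [hv, smul_smul, mul_inv_cancel₀ hx'.ne', one_smul]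
  set R : 𝔼 ≃ₗᵢ[ℝ] 𝔼 := (Submodule.span ℝ {e - v})ᗮ.reflection with hRdef
  have hRe : R e = v := Submodule.reflection_sub hvn
  rw [lintegral_comp_smul_of_pos (F x) hx']
  have h1 : ∀ y, F x (‖x‖ • y) = ENNReal.ofReal (‖x‖ ^ p) * F v y := by
    intro y
    have := hs ‖x‖ hx' v y
    rwa [← hxv] at this
  simp_rw [h1]
  rw [lintegral_const_mul' _ _ ENNReal.ofReal_ne_top, ← mul_assoc,
    ← ENNReal.ofReal_mul (by positivity), ← rpow_add hx', add_comm p]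
  congr 1
  rw [← R.measurePreserving.lintegral_comp_emb R.toHomeomorph.measurableEmbedding]
  exact lintegral_congr fun y => by rw [← hRe, hR]

/-! ### Gaussian integrals -/

lemma integral_gaussian_mul_gaussian_shift {a b : ℝ} (ha : 0 < a) (hb : 0 < b) (h : 𝔼) :
    Integrable (fun x : 𝔼 => exp (-(a * ‖x + h‖ ^ 2)) * exp (-(b * ‖x‖ ^ 2))) ∧
    ∫ x : 𝔼, exp (-(a * ‖x + h‖ ^ 2)) * exp (-(b * ‖x‖ ^ 2)) =
      (π / (a + b)) ^ ((d : ℝ) / 2) * exp (-(a * b / (a + b) * ‖h‖ ^ 2)) := by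
  have hab : 0 < a + b := by positivity
  have hc := GaussianFourier.integral_cexp_neg_mul_sq_norm_add (V := 𝔼) (b := ((a + b : ℝ) : ℂ))
    (by simpa using hab) ((-2 * a : ℝ) : ℂ) h
  have hr : ∫ x : 𝔼, exp (-(a + b) * ‖x‖ ^ 2 + -2 * a * inner ℝ h x) =
      (π / (a + b)) ^ ((d : ℝ) / 2) * exp ((-2 * a) ^ 2 * ‖h‖ ^ 2 / (4 * (a + b))) := by
    have : ∫ x : 𝔼, ((exp (-(a + b) * ‖x‖ ^ 2 + -2 * a * inner ℝ h x) : ℝ) : ℂ) =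
      (((π / (a + b)) ^ ((d : ℝ) / 2) *
        exp ((-2 * a) ^ 2 * ‖h‖ ^ 2 / (4 * (a + b))) : ℝ) : ℂ) := by
      rw [Complex.ofReal_mul, Complex.ofReal_cpow (by positivity)]
      push_cast at hc ⊢
      convert hc using 2
      simp
    rw [integral_complex_ofReal] at this
    exact_mod_cast this
  have hfun : ∀ x : 𝔼, exp (-(a * ‖x + h‖ ^ 2)) * exp (-(b * ‖x‖ ^ 2)) =
      exp (-(a * ‖h‖ ^ 2)) * exp (-(a + b) * ‖x‖ ^ 2 + -2 * a * inner ℝ h x) := by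
    intro x
    rw [← exp_add, ← exp_add, norm_add_sq_real, real_inner_comm]
    congr 1; ring
  have hval : ∫ x : 𝔼, exp (-(a * ‖x + h‖ ^ 2)) * exp (-(b * ‖x‖ ^ 2)) =
      (π / (a + b)) ^ ((d : ℝ) / 2) * exp (-(a * b / (a + b) * ‖h‖ ^ 2)) := by
    simp_rw [hfun]
    rw [integral_const_mul, hr, mul_left_comm, ← exp_add]
    congr 2
    field_simp
    ring
  refine ⟨?_, hval⟩
  by_contra hn
  rw [integral_undef hn] at hval
  have : 0 < (π / (a + b)) ^ ((d : ℝ) / 2) * exp (-(a * b / (a + b) * ‖h‖ ^ 2)) := by positivity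
  exact this.ne hval

lemma gaussian_sub_mul_gaussian_sub_nonneg {a b : ℝ} (ha : 0 ≤ a) (hb : 0 ≤ b) (x y : 𝔼) :
    0 ≤ (exp (-(a * ‖x‖ ^ 2)) - exp (-(a * ‖y‖ ^ 2))) *
      (exp (-(b * ‖x‖ ^ 2)) - exp (-(b * ‖y‖ ^ 2))) := by
  rcases le_total ‖x‖ ‖y‖ with h | h
  · refine mul_nonneg ?_ ?_ <;> rw [sub_nonneg] <;> gcongr
  · refine mul_nonneg_of_nonpos_of_nonpos ?_ ?_ <;> rw [sub_nonpos] <;> gcongr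

/-- The integrand is nonnegative because all Gaussians centred at the origin decrease in `|x|`
together. -/
lemma lintegral_gaussian_difference {a b : ℝ} (ha : 0 < a) (hb : 0 < b) (h : 𝔼) :
    ∫⁻ x : 𝔼, ENNReal.ofReal ((exp (-(a * ‖x‖ ^ 2)) - exp (-(a * ‖x + h‖ ^ 2))) *
      (exp (-(b * ‖x‖ ^ 2)) - exp (-(b * ‖x + h‖ ^ 2)))) =
    ENNReal.ofReal (2 * (π / (a + b)) ^ ((d : ℝ) / 2) *
      (1 - exp (-(a * b / (a + b) * ‖h‖ ^ 2)))) := by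
  obtain ⟨i1, e1⟩ := integral_gaussian_mul_gaussian_shift ha hb (0 : 𝔼)
  obtain ⟨i2, e2⟩ := integral_gaussian_mul_gaussian_shift ha hb h
  obtain ⟨i3, e3⟩ := integral_gaussian_mul_gaussian_shift hb ha h
  simp only [add_zero] at i1 e1
  have i4 := i1.comp_add_right h
  have e4 := integral_add_right_eq_self
    (μ := volume) (fun x : 𝔼 => exp (-(a * ‖x‖ ^ 2)) * exp (-(b * ‖x‖ ^ 2))) h
  rw [e1] at e4
  have hfun : (fun x : 𝔼 => (exp (-(a * ‖x‖ ^ 2)) - exp (-(a * ‖x + h‖ ^ 2))) *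
      (exp (-(b * ‖x‖ ^ 2)) - exp (-(b * ‖x + h‖ ^ 2)))) = fun x =>
      (exp (-(a * ‖x‖ ^ 2)) * exp (-(b * ‖x‖ ^ 2)) +
      exp (-(a * ‖x + h‖ ^ 2)) * exp (-(b * ‖x + h‖ ^ 2))) -
      (exp (-(a * ‖x + h‖ ^ 2)) * exp (-(b * ‖x‖ ^ 2)) +
      exp (-(b * ‖x + h‖ ^ 2)) * exp (-(a * ‖x‖ ^ 2))) := by
    funext x; ring
  rw [← ofReal_integral_eq_lintegral_ofReal]
  · rw [hfun, integral_sub, integral_add i1 i4, integral_add i2 i3,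
      e1, e2, e3, e4, add_comm b a, mul_comm b a]
    · congr 1
      simp
      ring
    · exact i1.add i4
    · exact i2.add i3
  · rw [hfun]
    exact (i1.add i4).sub (i2.add i3)
  · exact .of_forall fun x => gaussian_sub_mul_gaussian_sub_nonneg ha.le hb.le _ _

lemma lintegral_one_sub_cos_mul_gaussian {b : ℝ} (hb : 0 < b) (h : 𝔼) :
    ∫⁻ x : 𝔼, ENNReal.ofReal ((2 - 2 * cos (inner ℝ h x)) * exp (-(b * ‖x‖ ^ 2))) =
      ENNReal.ofReal (2 * (π / b) ^ ((d : ℝ) / 2) * (1 - exp (-(‖h‖ ^ 2 / (4 * b))))) := by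
  have hc : ∀ h : 𝔼, Integrable (fun x : 𝔼 => exp (-(b * ‖x‖ ^ 2)) * cos (inner ℝ h x)) ∧
      ∫ x : 𝔼, exp (-(b * ‖x‖ ^ 2)) * cos (inner ℝ h x) =
        (π / b) ^ ((d : ℝ) / 2) * exp (-(‖h‖ ^ 2 / (4 * b))) := by
    intro h
    have hc := GaussianFourier.integral_cexp_neg_mul_sq_norm_add (V := 𝔼) (b := (b : ℂ))
      (by simpa using hb) Complex.I h
    have hv : (π / (b : ℂ)) ^ ((Module.finrank ℝ 𝔼 : ℂ) / 2) *
        Complex.exp (Complex.I ^ 2 * ‖h‖ ^ 2 / (4 * b)) =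
        (((π / b) ^ ((d : ℝ) / 2) * exp (-(‖h‖ ^ 2 / (4 * b))) : ℝ) : ℂ) := by
      rw [Complex.ofReal_mul, Complex.ofReal_cpow (by positivity)]
      push_cast
      simp only [finrank_euclideanSpace_fin, Complex.I_sq]
      congr 2; ring
    rw [hv] at hc
    have hi : Integrable (fun v : 𝔼 =>
        Complex.exp (-b * ‖v‖ ^ 2 + Complex.I * (inner ℝ h v : ℝ))) := by
      by_contra hn
      rw [integral_undef hn] at hc
      have : 0 < (π / b) ^ ((d : ℝ) / 2) * exp (-(‖h‖ ^ 2 / (4 * b))) := by positivity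
      exact this.ne (by exact_mod_cast hc)
    have hre : ∀ v : 𝔼, RCLike.re (Complex.exp (-b * ‖v‖ ^ 2 + Complex.I * (inner ℝ h v : ℝ))) =
        exp (-(b * ‖v‖ ^ 2)) * cos (inner ℝ h v) := by
      intro v
      rw [RCLike.re_eq_complex_re, Complex.exp_re]
      simp [← Complex.ofReal_pow]
    have h1 := hi.re
    have h2 := integral_re hi
    simp_rw [hre] at h1 h2
    refine ⟨h1, ?_⟩
    rw [h2]
    exact (congrArg Complex.re hc).trans (Complex.ofReal_re _)
  obtain ⟨i0, e0⟩ := hc 0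
  obtain ⟨i1, e1⟩ := hc h
  simp only [inner_zero_left, cos_zero, mul_one] at i0 e0
  have hfun : (fun x : 𝔼 => (2 - 2 * cos (inner ℝ h x)) * exp (-(b * ‖x‖ ^ 2))) = fun x =>
      2 * (exp (-(b * ‖x‖ ^ 2)) - exp (-(b * ‖x‖ ^ 2)) * cos (inner ℝ h x)) := by
    funext x; ring
  rw [← ofReal_integral_eq_lintegral_ofReal]
  · rw [hfun, integral_const_mul, integral_sub i0 i1, e0, e1]
    congr 1
    simp
    ring
  · rw [hfun]
    exact (i0.sub i1).const_mul 2
  · refine .of_forall fun x => mul_nonneg ?_ (exp_pos _).le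
    linarith [cos_le_one (inner ℝ h x)]

/-! ### The symbol of the fractional Laplacian -/

lemma abs_Gamma_neg {s : ℝ} (hs0 : 0 < s) (hs1 : s < 1) : |Gamma (-s)| = Gamma (1 - s) / s := by
  have h := Gamma_add_one (s := -s) (by linarith)
  have hΓ : 0 < Gamma (1 - s) := Gamma_pos_of_pos (by linarith)
  rw [neg_add_eq_sub] at h
  have : Gamma (-s) = -(Gamma (1 - s) / s) := by rw [h]; field_simp
  rw [this, abs_neg, abs_of_pos (by positivity)]

lemma formConst_pos [NeZero d] {s : ℝ} (hs0 : 0 < s) (hs1 : s < 1) : 0 < formConst s d := by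
  have hd : 0 < (d : ℝ) := by exact_mod_cast Nat.pos_of_ne_zero (NeZero.ne d)
  have h1 : 0 < Gamma ((d + 2 * s) / 2) := Gamma_pos_of_pos (by positivity)
  have hΓ : 0 < Gamma (1 - s) := Gamma_pos_of_pos (by linarith)
  rw [formConst, abs_Gamma_neg hs0 hs1]
  have := pi_pos
  positivity

lemma hardyConst_pos {s : ℝ} (hs0 : 0 < s) (hs : s < (d : ℝ) / 2) : 0 < hardyConst s d := by
  have h1 : 0 < Gamma ((d + 2 * s) / 4) := Gamma_pos_of_pos (by linarith)
  have h2 : 0 < Gamma ((d - 2 * s) / 4) := Gamma_pos_of_pos (by linarith)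
  rw [hardyConst]
  positivity

/-- `∫ |1 - e^(iξ·h)|² |h|^(-d-2s) dh = |ξ|^(2s) / a_{s,d}`. Homogeneity gives a multiple of
`|ξ|^(2s)`, and integrating against a Gaussian in `ξ` determines the factor. -/
lemma lintegral_one_sub_cos_mul_rpow [NeZero d] {s : ℝ} (hs0 : 0 < s) (hs1 : s < 1) (ξ : 𝔼) :
    ∫⁻ h : 𝔼, ENNReal.ofReal ((2 - 2 * cos (inner ℝ h ξ)) * ‖h‖ ^ (-(d + 2 * s))) =
      ENNReal.ofReal (‖ξ‖ ^ (2 * s) * (formConst s d)⁻¹) := by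
  have hd : 0 < (d : ℝ) := by exact_mod_cast Nat.pos_of_ne_zero (NeZero.ne d)
  have hcos : ∀ t, 0 ≤ 2 - 2 * cos t := fun t => by linarith [cos_le_one t]
  obtain ⟨e, he⟩ : ∃ e : 𝔼, ‖e‖ = 1 := exists_norm_eq 𝔼 zero_le_one
  set F : 𝔼 → 𝔼 → ENNReal := fun x y =>
    ENNReal.ofReal ((2 - 2 * cos (inner ℝ y x / ‖x‖ ^ 2)) * ‖y‖ ^ (-(d + 2 * s))) with hF
  set γ := ∫⁻ y, F e y with hγ
  -- `F` is evaluated at the inversion `ξ / |ξ|²` of `ξ`.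
  have hhom : ∀ ξ : 𝔼, ξ ≠ 0 →
      ∫⁻ h : 𝔼, ENNReal.ofReal ((2 - 2 * cos (inner ℝ h ξ)) * ‖h‖ ^ (-(d + 2 * s))) =
      ENNReal.ofReal (‖ξ‖ ^ (2 * s)) * γ := by
    intro ξ hξ
    have hξ' : 0 < ‖ξ‖ := norm_pos_iff.2 hξ
    have hx : (‖ξ‖ ^ 2)⁻¹ • ξ ≠ 0 := smul_ne_zero (by positivity) hξ
    have := lintegral_of_homogeneous (F := F) (p := -(d + 2 * s)) (e := e)
      (x := (‖ξ‖ ^ 2)⁻¹ • ξ) ?_ ?_ he hx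
    · have hn : ‖(‖ξ‖ ^ 2)⁻¹ • ξ‖ = ‖ξ‖⁻¹ := by
        rw [norm_smul, norm_inv, norm_pow, norm_norm]; field_simp
      rw [hn, inv_rpow hξ'.le, ← rpow_neg hξ'.le] at this
      rw [show 2 * s = -(-(d + 2 * s) + d) by ring, ← this]
      refine lintegral_congr fun h => ?_
      simp only [hF, hn, inner_smul_right]
      rw [show (‖ξ‖ ^ 2)⁻¹ * inner ℝ h ξ / ‖ξ‖⁻¹ ^ 2 = inner ℝ h ξ by field_simp]
      congr 3; ring
    · intro R x y
      simp [hF]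
    · intro r hr x y
      simp only [hF]
      rw [← ENNReal.ofReal_mul (by positivity), norm_smul, norm_smul, inner_smul_left,
        inner_smul_right, norm_of_nonneg hr.le, mul_rpow hr.le (norm_nonneg _)]
      have : (starRingEnd ℝ) r * (r * inner ℝ y x) / (r * ‖x‖) ^ 2 = inner ℝ y x / ‖x‖ ^ 2 := by
        rw [conj_trivial, mul_pow]; field_simp
      rw [this]
      congr 1; ring
  have h0 : ∀ᵐ x : 𝔼, x ≠ 0 := by simp [ae_iff]
  have hΓ1 : 0 < Gamma (1 - s) := Gamma_pos_of_pos (by linarith)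
  have hΓ2 : 0 < Gamma ((d + 2 * s) / 2) := Gamma_pos_of_pos (by linarith)
  have hS := sphereArea_pos (d := d)
  have hI : ∫⁻ ξ : 𝔼, ENNReal.ofReal (exp (-((1 / 4) * ‖ξ‖ ^ 2))) *
      ∫⁻ h : 𝔼, ENNReal.ofReal ((2 - 2 * cos (inner ℝ h ξ)) * ‖h‖ ^ (-(d + 2 * s))) =
      ENNReal.ofReal (sphereArea d / 2 * (1 / 4) ^ (-((d + 2 * s) / 2)) * Gamma ((d + 2 * s) / 2))
        * γ := by
    rw [← lintegral_rpow_norm_mul_gaussian (by linarith) (by norm_num),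
      ← lintegral_mul_const _ (by fun_prop)]
    refine lintegral_congr_ae (h0.mono fun ξ hξ => ?_)
    simp only [hhom ξ hξ]
    rw [← mul_assoc, ← ENNReal.ofReal_mul (by positivity), mul_comm (exp _)]
  -- The same integral over `ξ` and `h`, with the `ξ`-integral evaluated first.
  have hJ : ∫⁻ ξ : 𝔼, ENNReal.ofReal (exp (-((1 / 4) * ‖ξ‖ ^ 2))) *
      ∫⁻ h : 𝔼, ENNReal.ofReal ((2 - 2 * cos (inner ℝ h ξ)) * ‖h‖ ^ (-(d + 2 * s))) =
      ENNReal.ofReal (2 * (π / (1 / 4)) ^ ((d : ℝ) / 2) *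
        (sphereArea d / 2 * (Gamma (1 - s) / s))) := by
    simp_rw [← lintegral_const_mul' _ _ ENNReal.ofReal_ne_top]
    rw [lintegral_lintegral_swap (by fun_prop)]
    rw [ENNReal.ofReal_mul (by positivity), ← lintegral_one_sub_gaussian_mul_rpow hs0 hs1,
      ← lintegral_const_mul _ (by fun_prop)]
    refine lintegral_congr fun h => ?_
    have : ∀ ξ : 𝔼, ENNReal.ofReal (exp (-((1 / 4) * ‖ξ‖ ^ 2))) *
        ENNReal.ofReal ((2 - 2 * cos (inner ℝ h ξ)) * ‖h‖ ^ (-(d + 2 * s))) =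
        ENNReal.ofReal (‖h‖ ^ (-(d + 2 * s))) *
        ENNReal.ofReal ((2 - 2 * cos (inner ℝ h ξ)) * exp (-((1 / 4) * ‖ξ‖ ^ 2))) := by
      intro ξ
      rw [← ENNReal.ofReal_mul (by positivity), ← ENNReal.ofReal_mul (by positivity)]
      congr 1; ring
    simp_rw [this]
    rw [lintegral_const_mul _ (by fun_prop), lintegral_one_sub_cos_mul_gaussian (by norm_num),
      ← ENNReal.ofReal_mul (by positivity), ← ENNReal.ofReal_mul (by positivity)]
    congr 1
    norm_num
    ring
  rw [hI] at hJ
  have hγv : γ = ENNReal.ofReal (formConst s d)⁻¹ := by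
    set A := sphereArea d / 2 * (1 / 4) ^ (-((d + 2 * s) / 2)) * Gamma ((d + 2 * s) / 2) with hA
    have hApos : 0 < A := by positivity
    rw [← ENNReal.mul_right_inj (a := ENNReal.ofReal A) (by simpa using hApos)
      ENNReal.ofReal_ne_top, hJ, ← ENNReal.ofReal_mul hApos.le]
    congr 1
    have h4 : ((1 : ℝ) / 4) ^ (-((d + 2 * s) / 2)) = 2 ^ (d : ℝ) * 2 ^ (2 * s) := by
      rw [one_div, inv_rpow (by norm_num), ← rpow_neg (by norm_num), neg_neg,
        show (4 : ℝ) = 2 ^ (2 : ℝ) by norm_num, ← rpow_mul (by norm_num),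
        ← rpow_add (by norm_num)]
      congr 1; ring
    have h5 : (π / (1 / 4)) ^ ((d : ℝ) / 2) = π ^ ((d : ℝ) / 2) * 2 ^ (d : ℝ) := by
      rw [div_div_eq_mul_div, div_one, mul_rpow pi_pos.le (by norm_num),
        show (4 : ℝ) = 2 ^ (2 : ℝ) by norm_num, ← rpow_mul (by norm_num)]
      congr 2; ring
    rw [hA, h4, h5, formConst, abs_Gamma_neg hs0 hs1, neg_div, rpow_neg pi_pos.le,
      rpow_sub two_pos, rpow_one]
    have := pi_pos
    field_simp
  by_cases hξ : ξ = 0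
  · subst hξ
    simp [zero_rpow (mul_pos two_pos hs0).ne']
  · rw [hhom ξ hξ, hγv, ENNReal.ofReal_mul (by positivity)]

/-! ### The energy pairing of the ground state with a Gaussian -/

/-- The ground state `|x|^(-(d-2s)/2)`. -/
noncomputable def groundState (s : ℝ) (x : 𝔼) : ℝ := ‖x‖ ^ (-(((d : ℝ) - 2 * s) / 2))

/-- The kernel `|x-y|^(-(d+2s))`. It is `0` on the diagonal, by the junk value of `rpow`. -/
noncomputable def rieszKernel (s : ℝ) (x y : 𝔼) : ℝ := ‖x - y‖ ^ (-((d : ℝ) + 2 * s))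

@[fun_prop]
lemma measurable_groundState (s : ℝ) : Measurable (groundState (d := d) s) := by
  unfold groundState; fun_prop

@[fun_prop]
lemma measurable_rieszKernel (s : ℝ) :
    Measurable (fun p : 𝔼 × 𝔼 => rieszKernel s p.1 p.2) := by
  unfold rieszKernel; fun_prop

lemma groundState_nonneg (s : ℝ) (x : 𝔼) : 0 ≤ groundState s x := by
  unfold groundState; positivity

lemma rieszKernel_nonneg (s : ℝ) (x y : 𝔼) : 0 ≤ rieszKernel s x y := by
  unfold rieszKernel; positivity

lemma lintegral_lintegral_shift (F : 𝔼 → 𝔼 → ENNReal)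
    (hF : Measurable (fun p : 𝔼 × 𝔼 => F p.1 p.2)) :
    ∫⁻ x, ∫⁻ y, F x y = ∫⁻ h, ∫⁻ x, F x (x + h) := by
  have h1 : ∀ x, ∫⁻ y, F x y = ∫⁻ h, F x (x + h) := fun x =>
    (lintegral_add_left_eq_self (fun y => F x y) x).symm
  simp_rw [h1]
  rw [lintegral_lintegral_swap]
  exact (hF.comp (measurable_fst.prodMk (measurable_fst.add measurable_snd))).aemeasurable

lemma lintegral_one_sub_gaussian_mul_rpow_scaled [NeZero d] {s c : ℝ} (hs0 : 0 < s) (hs1 : s < 1)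
    (hc : 0 < c) :
    ∫⁻ x : 𝔼, ENNReal.ofReal ((1 - exp (-(c * ‖x‖ ^ 2))) * ‖x‖ ^ (-(d + 2 * s))) =
      ENNReal.ofReal (c ^ s * (sphereArea d / 2 * (Gamma (1 - s) / s))) := by
  have hc' : 0 < c ^ (1 / 2 : ℝ) := by positivity
  rw [ENNReal.ofReal_mul (by positivity), ← lintegral_one_sub_gaussian_mul_rpow hs0 hs1,
    lintegral_comp_smul_of_pos
      (fun x : 𝔼 => ENNReal.ofReal ((1 - exp (-‖x‖ ^ 2)) * ‖x‖ ^ (-(d + 2 * s)))) hc',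
    ← mul_assoc, ← ENNReal.ofReal_mul (by positivity),
    ← lintegral_const_mul' _ _ ENNReal.ofReal_ne_top]
  refine lintegral_congr fun x => ?_
  have h2 : (c ^ (1 / 2 : ℝ)) ^ 2 = c := by
    rw [← rpow_natCast, ← rpow_mul hc.le]; norm_num
  rw [← ENNReal.ofReal_mul (by positivity), norm_smul, norm_of_nonneg hc'.le, mul_pow, h2,
    mul_rpow hc'.le (norm_nonneg _), ← rpow_mul hc.le, ← rpow_mul hc.le]
  congr 1
  have h3 : c ^ s * c ^ (1 / 2 * (d : ℝ)) * c ^ (1 / 2 * -(d + 2 * s)) = 1 := by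
    rw [← rpow_add hc, ← rpow_add hc]
    convert rpow_zero c using 2
    ring
  linear_combination (-(1 - exp (-(c * ‖x‖ ^ 2))) * ‖x‖ ^ (-((d : ℝ) + 2 * s))) * h3

lemma gaussian_energy [NeZero d] {s a b : ℝ} (hs0 : 0 < s) (hs1 : s < 1) (ha : 0 < a)
    (hb : 0 < b) :
    ∫⁻ x : 𝔼, ∫⁻ y : 𝔼, ENNReal.ofReal ((exp (-(a * ‖x‖ ^ 2)) - exp (-(a * ‖y‖ ^ 2))) *
      (exp (-(b * ‖x‖ ^ 2)) - exp (-(b * ‖y‖ ^ 2))) * rieszKernel s x y) =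
    ENNReal.ofReal (2 * (π / (a + b)) ^ ((d : ℝ) / 2) * ((a * b / (a + b)) ^ s *
      (sphereArea d / 2 * (Gamma (1 - s) / s)))) := by
  have hab : 0 < a + b := by positivity
  rw [lintegral_lintegral_shift _ (by fun_prop), ENNReal.ofReal_mul (by positivity),
    ← lintegral_one_sub_gaussian_mul_rpow_scaled hs0 hs1 (by positivity),
    ← lintegral_const_mul' _ _ ENNReal.ofReal_ne_top]
  refine lintegral_congr fun h => ?_
  have h1 : ∀ x : 𝔼, rieszKernel s x (x + h) = ‖h‖ ^ (-((d : ℝ) + 2 * s)) := by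
    intro x; simp [rieszKernel]
  simp_rw [h1]
  have h2 := fun x : 𝔼 => gaussian_sub_mul_gaussian_sub_nonneg ha.le hb.le x (x + h)
  simp_rw [fun x => ENNReal.ofReal_mul (q := ‖h‖ ^ (-((d : ℝ) + 2 * s))) (h2 x)]
  rw [lintegral_mul_const' _ _ ENNReal.ofReal_ne_top, lintegral_gaussian_difference ha hb,
    ← ENNReal.ofReal_mul' (by positivity), ← ENNReal.ofReal_mul (by positivity)]
  congr 1; ring

lemma groundState_sub_mul_gaussian_sub_nonneg {s : ℝ} (hs : s < (d : ℝ) / 2) {x y : 𝔼}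
    (hx : x ≠ 0) (hy : y ≠ 0) :
    0 ≤ (groundState s x - groundState s y) * (exp (-‖x‖ ^ 2) - exp (-‖y‖ ^ 2)) := by
  have hx' : 0 < ‖x‖ := norm_pos_iff.2 hx
  have hy' : 0 < ‖y‖ := norm_pos_iff.2 hy
  have hα : -(((d : ℝ) - 2 * s) / 2) ≤ 0 := by linarith
  unfold groundState
  rcases le_total ‖x‖ ‖y‖ with h | h
  · refine mul_nonneg ?_ ?_ <;> rw [sub_nonneg]
    · exact rpow_le_rpow_of_nonpos hx' h hα
    · gcongr
  · refine mul_nonneg_of_nonpos_of_nonpos ?_ ?_ <;> rw [sub_nonpos]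
    · exact rpow_le_rpow_of_nonpos hy' h hα
    · gcongr

/-- The ground state is a superposition of Gaussians `exp(-τ|x|²)` with positive coefficients, so
the energy pairing with a Gaussian is a positive superposition of Gaussian pairings. -/
lemma groundState_gaussian_energy [NeZero d] {s : ℝ} (hs0 : 0 < s) (hs1 : s < 1)
    (hs : s < (d : ℝ) / 2) :
    ∫⁻ x : 𝔼, ∫⁻ y : 𝔼, ENNReal.ofReal ((groundState s x - groundState s y) *
      (exp (-‖x‖ ^ 2) - exp (-‖y‖ ^ 2)) * rieszKernel s x y) =
    ENNReal.ofReal (hardyConst s d * (formConst s d)⁻¹ *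
      (sphereArea d / 2 * Gamma ((d - 2 * s) / 4))) := by
  have hd : 0 < (d : ℝ) := by exact_mod_cast Nat.pos_of_ne_zero (NeZero.ne d)
  have hΓ1 : 0 < Gamma ((d - 2 * s) / 4) := Gamma_pos_of_pos (by linarith)
  have hΓ2 : 0 < Gamma ((d + 2 * s) / 4) := Gamma_pos_of_pos (by linarith)
  have hΓ3 : 0 < Gamma ((d + 2 * s) / 2) := Gamma_pos_of_pos (by linarith)
  have hΓ4 : 0 < Gamma (1 - s) := Gamma_pos_of_pos (by linarith)
  have hΓ5 : 0 < Gamma ((d : ℝ) / 2) := Gamma_pos_of_pos (by linarith)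
  have hS := sphereArea_pos (d := d)
  set β := ((d : ℝ) - 2 * s) / 4 with hβ
  have hβpos : 0 < β := by rw [hβ]; linarith
  have hw : ∀ x : 𝔼, x ≠ 0 → IntegrableOn (fun τ => τ ^ (β - 1) * exp (-(‖x‖ ^ 2 * τ))) (Ioi 0) ∧
      ∫ τ in Ioi (0 : ℝ), τ ^ (β - 1) * exp (-(‖x‖ ^ 2 * τ)) = groundState s x * Gamma β := by
    intro x hx
    have hx' : 0 < ‖x‖ := norm_pos_iff.2 hx
    have h := integral_rpow_mul_exp_neg_mul_Ioi hβpos (r := ‖x‖ ^ 2) (by positivity)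
    have h2 : (1 / ‖x‖ ^ 2) ^ β = groundState s x := by
      rw [groundState, one_div, inv_rpow (by positivity), ← rpow_neg (by positivity), ← rpow_natCast,
        ← rpow_mul hx'.le]
      congr 1; rw [hβ]; push_cast; ring
    rw [h2] at h
    refine ⟨?_, h⟩
    by_contra hn
    rw [integral_undef hn] at h
    have : 0 < groundState s x * Gamma β := by unfold groundState; positivity
    exact this.ne h
  have key : ∀ x : 𝔼, x ≠ 0 → ∀ y : 𝔼, y ≠ 0 →
      ENNReal.ofReal ((groundState s x - groundState s y) *
        (exp (-‖x‖ ^ 2) - exp (-‖y‖ ^ 2)) * rieszKernel s x y) =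
      ∫⁻ τ in Ioi (0 : ℝ), ENNReal.ofReal ((Gamma β)⁻¹ * τ ^ (β - 1)) *
        ENNReal.ofReal ((exp (-(τ * ‖x‖ ^ 2)) - exp (-(τ * ‖y‖ ^ 2))) *
          (exp (-(1 * ‖x‖ ^ 2)) - exp (-(1 * ‖y‖ ^ 2))) * rieszKernel s x y) := by
    intro x hx y hy
    obtain ⟨ix, ex⟩ := hw x hx
    obtain ⟨iy, ey⟩ := hw y hy
    have hval : ∫ τ in Ioi (0 : ℝ), ((Gamma β)⁻¹ * ((exp (-‖x‖ ^ 2) - exp (-‖y‖ ^ 2)) *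
        rieszKernel s x y)) * (τ ^ (β - 1) * exp (-(‖x‖ ^ 2 * τ)) -
          τ ^ (β - 1) * exp (-(‖y‖ ^ 2 * τ))) =
        (groundState s x - groundState s y) *
        (exp (-‖x‖ ^ 2) - exp (-‖y‖ ^ 2)) * rieszKernel s x y := by
      rw [integral_const_mul, integral_sub ix iy, ex, ey]
      field_simp
    rw [← hval, ofReal_integral_eq_lintegral_ofReal]
    · refine setLIntegral_congr_fun measurableSet_Ioi fun τ hτ => ?_
      have : 0 < τ := hτ
      simp only [one_mul]
      rw [← ENNReal.ofReal_mul (by positivity)]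
      congr 1
      rw [mul_comm τ, mul_comm τ, neg_mul_eq_neg_mul, neg_mul_eq_neg_mul]
      ring_nf
    · exact (ix.sub iy).const_mul _
    · refine (ae_restrict_iff' measurableSet_Ioi).2 (.of_forall fun τ hτ => ?_)
      have hτ' : 0 < τ := hτ
      have h1 := gaussian_sub_mul_gaussian_sub_nonneg hτ'.le zero_le_one x y
      have h2 := rieszKernel_nonneg s x y
      have h3 : 0 ≤ (Gamma β)⁻¹ * τ ^ (β - 1) := by positivity
      refine (mul_nonneg h3 (mul_nonneg h1 h2)).trans_eq ?_
      simp only [one_mul]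
      rw [mul_comm τ, mul_comm τ]
      ring_nf
  have h0 : ∀ᵐ x : 𝔼, x ≠ 0 := by simp [ae_iff]
  have step1 : ∫⁻ x : 𝔼, ∫⁻ y : 𝔼, ENNReal.ofReal ((groundState s x - groundState s y) *
      (exp (-‖x‖ ^ 2) - exp (-‖y‖ ^ 2)) * rieszKernel s x y) =
      ∫⁻ τ in Ioi (0 : ℝ), ∫⁻ x : 𝔼, ∫⁻ y : 𝔼, ENNReal.ofReal ((Gamma β)⁻¹ * τ ^ (β - 1)) *
        ENNReal.ofReal ((exp (-(τ * ‖x‖ ^ 2)) - exp (-(τ * ‖y‖ ^ 2))) *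
          (exp (-(1 * ‖x‖ ^ 2)) - exp (-(1 * ‖y‖ ^ 2))) * rieszKernel s x y) := by
    have hmeas : Measurable (fun q : (𝔼 × ℝ) × 𝔼 =>
        ENNReal.ofReal ((Gamma β)⁻¹ * q.1.2 ^ (β - 1)) *
        ENNReal.ofReal ((exp (-(q.1.2 * ‖q.1.1‖ ^ 2)) - exp (-(q.1.2 * ‖q.2‖ ^ 2))) *
          (exp (-(1 * ‖q.1.1‖ ^ 2)) - exp (-(1 * ‖q.2‖ ^ 2))) * rieszKernel s q.1.1 q.2)) := by
      unfold rieszKernel; fun_prop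
    refine (lintegral_congr_ae (h0.mono fun x hx => ?_)).trans
      (lintegral_lintegral_swap hmeas.lintegral_prod_right'.aemeasurable)
    exact (lintegral_congr_ae (h0.mono fun y hy => key x hx y hy)).trans
      (lintegral_lintegral_swap (hmeas.comp (f := fun q : 𝔼 × ℝ => ((x, q.2), q.1))
        (by fun_prop)).aemeasurable)
  rw [step1]
  have step2 : ∀ τ ∈ Ioi (0 : ℝ),
      ∫⁻ x : 𝔼, ∫⁻ y : 𝔼, ENNReal.ofReal ((Gamma β)⁻¹ * τ ^ (β - 1)) *
        ENNReal.ofReal ((exp (-(τ * ‖x‖ ^ 2)) - exp (-(τ * ‖y‖ ^ 2))) *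
          (exp (-(1 * ‖x‖ ^ 2)) - exp (-(1 * ‖y‖ ^ 2))) * rieszKernel s x y) =
      ENNReal.ofReal ((Gamma β)⁻¹ * 2 * π ^ ((d : ℝ) / 2) *
        (sphereArea d / 2 * (Gamma (1 - s) / s))) *
      ENNReal.ofReal (τ ^ ((d + 2 * s) / 4 - 1) *
        (1 + τ) ^ (-((d + 2 * s) / 4 + (d + 2 * s) / 4))) := by
    intro τ hτ
    have hτ : 0 < τ := hτ
    simp_rw [lintegral_const_mul' _ _ ENNReal.ofReal_ne_top]
    rw [gaussian_energy hs0 hs1 hτ one_pos, ← ENNReal.ofReal_mul (by positivity),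
      ← ENNReal.ofReal_mul (by positivity)]
    congr 1
    have e1 : τ ^ (((d : ℝ) + 2 * s) / 4 - 1) = τ ^ (β - 1) * τ ^ s := by
      rw [← rpow_add hτ]; congr 1; rw [hβ]; ring
    have e2 : (1 + τ) ^ (-(((d : ℝ) + 2 * s) / 4 + (d + 2 * s) / 4)) =
        ((1 + τ) ^ ((d : ℝ) / 2))⁻¹ * ((1 + τ) ^ s)⁻¹ := by
      rw [← rpow_neg (by positivity), ← rpow_neg (by positivity), ← rpow_add (by positivity)]
      congr 1; ring
    rw [e1, e2, mul_one, add_comm τ, div_rpow pi_pos.le (by positivity),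
      div_rpow hτ.le (by positivity)]
    field_simp
  rw [setLIntegral_congr_fun measurableSet_Ioi step2, lintegral_const_mul' _ _ ENNReal.ofReal_ne_top,
    lintegral_beta (by linarith) (by linarith), ← ENNReal.ofReal_mul (by positivity)]
  congr 1
  rw [hardyConst, formConst, abs_Gamma_neg hs0 hs1, neg_div, rpow_neg pi_pos.le,
    rpow_sub two_pos, rpow_one,
    show ((d : ℝ) + 2 * s) / 4 + (d + 2 * s) / 4 = (d + 2 * s) / 2 by ring, ← hβ]
  have := pi_pos
  field_simp

/-! ### The ground state representation of the Gagliardo seminorm -/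

lemma lintegral_groundState_mul_gaussian [NeZero d] {s : ℝ} (hs : s < (d : ℝ) / 2) :
    ∫⁻ x : 𝔼, ENNReal.ofReal (‖x‖ ^ (-((d : ℝ) + 2 * s) / 2) * exp (-‖x‖ ^ 2)) =
      ENNReal.ofReal (sphereArea d / 2 * Gamma ((d - 2 * s) / 4)) := by
  have h := lintegral_rpow_norm_mul_gaussian (d := d) (p := -((d : ℝ) + 2 * s) / 2) (t := 1)
    (by linarith) one_pos
  simp only [one_mul, one_rpow, mul_one] at h
  rw [h]
  congr 3; ring

/-- Integrability of `w(y) |y|^(-(d+2s))` at infinity, and of `w` near the origin. -/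
lemma lintegral_groundState_mul_one_add_lt_top [NeZero d] {s : ℝ} (hs0 : 0 < s)
    (hs : s < (d : ℝ) / 2) :
    ∫⁻ y : 𝔼, ENNReal.ofReal (groundState s y * (1 + ‖y‖) ^ (-((d : ℝ) + 2 * s))) < ⊤ := by
  have hd : 0 < (d : ℝ) := by exact_mod_cast Nat.pos_of_ne_zero (NeZero.ne d)
  have hb : ∀ y : 𝔼, ENNReal.ofReal (groundState s y * (1 + ‖y‖) ^ (-((d : ℝ) + 2 * s))) ≤
      ENNReal.ofReal (exp 1) *
        ENNReal.ofReal (‖y‖ ^ (-(((d : ℝ) - 2 * s) / 2)) * exp (-(1 * ‖y‖ ^ 2))) +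
      ENNReal.ofReal ((1 + ‖y‖) ^ (-((d : ℝ) + 2 * s))) := by
    intro y
    rw [← ENNReal.ofReal_mul (by positivity), ← ENNReal.ofReal_add (by positivity) (by positivity)]
    refine ENNReal.ofReal_le_ofReal ?_
    have h1 : (1 + ‖y‖) ^ (-((d : ℝ) + 2 * s)) ≤ 1 :=
      rpow_le_one_of_one_le_of_nonpos (by linarith [norm_nonneg y]) (by linarith)
    have h2 : 0 ≤ (1 + ‖y‖) ^ (-((d : ℝ) + 2 * s)) := by positivity
    have h3 := groundState_nonneg s y
    rcases le_total ‖y‖ 1 with hy | hy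
    · have : 1 ≤ exp 1 * exp (-(1 * ‖y‖ ^ 2)) := by
        rw [← exp_add]
        exact one_le_exp (by nlinarith [norm_nonneg y])
      have h4 : groundState s y ≤ groundState s y * (exp 1 * exp (-(1 * ‖y‖ ^ 2))) :=
        le_mul_of_one_le_right h3 this
      have h5 : groundState s y * (1 + ‖y‖) ^ (-((d : ℝ) + 2 * s)) ≤ groundState s y :=
        mul_le_of_le_one_right h3 h1
      unfold groundState at *
      nlinarith
    · have : groundState s y ≤ 1 :=
        rpow_le_one_of_one_le_of_nonpos hy (by linarith)
      have h6 : groundState s y * (1 + ‖y‖) ^ (-((d : ℝ) + 2 * s)) ≤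
          (1 + ‖y‖) ^ (-((d : ℝ) + 2 * s)) := mul_le_of_le_one_left h2 this
      have h7 : 0 ≤ exp 1 * (‖y‖ ^ (-(((d : ℝ) - 2 * s) / 2)) * exp (-(1 * ‖y‖ ^ 2))) := by
        positivity
      linarith
  refine (lintegral_mono hb).trans_lt ?_
  rw [lintegral_add_right _ (by fun_prop), lintegral_const_mul' _ _ ENNReal.ofReal_ne_top,
    lintegral_rpow_norm_mul_gaussian (by linarith) one_pos]
  refine ENNReal.add_lt_top.2 ⟨ENNReal.mul_lt_top ENNReal.ofReal_lt_top ENNReal.ofReal_lt_top, ?_⟩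
  exact finite_integral_one_add_norm (by simp; linarith)

/-- The kernel `|x-y|^(-(d+2s))` restricted to the scale invariant region
`|x| + |y| ≤ (n+1) |x-y|`, which stays away from the diagonal. -/
noncomputable def truncatedKernel (s : ℝ) (n : ℕ) (x y : 𝔼) : ENNReal :=
  {p : 𝔼 × 𝔼 | ‖p.1‖ + ‖p.2‖ ≤ (n + 1) * ‖p.1 - p.2‖}.indicator
    (fun p => ENNReal.ofReal (rieszKernel s p.1 p.2)) (x, y)

@[fun_prop]
lemma measurable_truncatedKernel (s : ℝ) (n : ℕ) :
    Measurable (fun p : 𝔼 × 𝔼 => truncatedKernel s n p.1 p.2) := by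
  unfold truncatedKernel
  refine Measurable.indicator (by fun_prop) ?_
  exact measurableSet_le (by fun_prop) (by fun_prop)

lemma truncatedKernel_comm (s : ℝ) (n : ℕ) (x y : 𝔼) :
    truncatedKernel s n x y = truncatedKernel s n y x := by
  simp only [truncatedKernel, indicator, mem_ofPred_eq, rieszKernel, norm_sub_rev x y,
    add_comm ‖x‖]

lemma truncatedKernel_smul (s : ℝ) (n : ℕ) {r : ℝ} (hr : 0 < r) (x y : 𝔼) :
    truncatedKernel s n (r • x) (r • y) =
      ENNReal.ofReal (r ^ (-((d : ℝ) + 2 * s))) * truncatedKernel s n x y := by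
  simp only [truncatedKernel, indicator, mem_ofPred_eq, rieszKernel, ← smul_sub, norm_smul,
    norm_of_nonneg hr.le, ← mul_add, mul_left_comm _ r, mul_le_mul_iff_right₀ hr]
  split_ifs
  · rw [← ENNReal.ofReal_mul (by positivity), mul_rpow hr.le (norm_nonneg _)]
  · simp

lemma truncatedKernel_map (s : ℝ) (n : ℕ) (R : 𝔼 ≃ₗᵢ[ℝ] 𝔼) (x y : 𝔼) :
    truncatedKernel s n (R x) (R y) = truncatedKernel s n x y := by
  simp only [truncatedKernel, indicator, mem_ofPred_eq, rieszKernel, ← map_sub,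
    LinearIsometryEquiv.norm_map]

lemma truncatedKernel_mono (s : ℝ) (x y : 𝔼) : Monotone fun n => truncatedKernel s n x y := by
  intro m n hmn
  refine indicator_le_indicator_of_subset (fun p hp => ?_) (fun _ => zero_le) _
  simp only [mem_ofPred_eq] at hp ⊢
  refine hp.trans ?_
  gcongr

lemma tendsto_truncatedKernel [NeZero d] {s : ℝ} (hs0 : 0 < s) (x y : 𝔼) :
    Tendsto (fun n => truncatedKernel s n x y) atTop (𝓝 (ENNReal.ofReal (rieszKernel s x y))) := by
  have hd : 0 < (d : ℝ) := by exact_mod_cast Nat.pos_of_ne_zero (NeZero.ne d)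
  by_cases hxy : x = y
  · subst hxy
    have : rieszKernel s x x = 0 := by
      rw [rieszKernel, sub_self, norm_zero, zero_rpow (by linarith)]
    simp [truncatedKernel, indicator, this]
  · have hpos : 0 < ‖x - y‖ := norm_pos_iff.2 (sub_ne_zero.2 hxy)
    obtain ⟨N, hN⟩ := exists_nat_ge ((‖x‖ + ‖y‖) / ‖x - y‖)
    refine tendsto_atTop_of_eventually_const (i₀ := N) fun n hn => ?_
    have : ‖x‖ + ‖y‖ ≤ (n + 1) * ‖x - y‖ := by
      rw [div_le_iff₀ hpos] at hN
      have : (N : ℝ) ≤ n := by exact_mod_cast hn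
      nlinarith
    simp [truncatedKernel, indicator, this]

lemma truncatedKernel_le {s : ℝ} (hs0 : 0 < s) (n : ℕ) {e : 𝔼} (he : ‖e‖ = 1) (y : 𝔼) :
    truncatedKernel s n e y ≤ ENNReal.ofReal ((n + 1) ^ ((d : ℝ) + 2 * s)) *
      ENNReal.ofReal ((1 + ‖y‖) ^ (-((d : ℝ) + 2 * s))) := by
  simp only [truncatedKernel, indicator, mem_ofPred_eq, rieszKernel, he]
  split_ifs with h
  · rw [← ENNReal.ofReal_mul (by positivity)]
    refine ENNReal.ofReal_le_ofReal ?_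
    have h1 : (1 + ‖y‖) / (n + 1) ≤ ‖e - y‖ := by
      rw [div_le_iff₀ (by positivity)]; linarith
    have hy := norm_nonneg y
    refine (rpow_le_rpow_of_nonpos (by positivity) h1 ?_).trans_eq ?_
    · have : (0 : ℝ) ≤ d := by positivity
      linarith
    · rw [div_rpow (by positivity) (by positivity), rpow_neg (x := (n : ℝ) + 1) (by positivity)]
      field_simp
  · simp

/-- The off-diagonal products `w(y) f(x)`: the integral of `w` against the truncated kernel is
homogeneous in `x`. -/
lemma lintegral_groundState_mul_truncatedKernel [NeZero d] {s : ℝ} (n : ℕ) {e : 𝔼} (he : ‖e‖ = 1)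
    {f : 𝔼 → ℝ} (hf : Measurable f) (hf0 : ∀ x, 0 ≤ f x) :
    ∫⁻ x, ∫⁻ y, ENNReal.ofReal (groundState s y * f x) * truncatedKernel s n x y =
      (∫⁻ y, ENNReal.ofReal (groundState s y) * truncatedKernel s n e y) *
        ∫⁻ x : 𝔼, ENNReal.ofReal (‖x‖ ^ (-((d : ℝ) + 2 * s) / 2) * f x) := by
  have h0 : ∀ᵐ x : 𝔼, x ≠ 0 := by simp [ae_iff]
  rw [mul_comm, ← lintegral_mul_const _ (by fun_prop)]
  refine lintegral_congr_ae (h0.mono fun x hx => ?_)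
  have hx' : 0 < ‖x‖ := norm_pos_iff.2 hx
  have hh := lintegral_of_homogeneous (d := d)
    (F := fun x y => ENNReal.ofReal (groundState s y) * truncatedKernel s n x y)
    (p := -(((d : ℝ) - 2 * s) / 2) + -((d : ℝ) + 2 * s)) ?_ ?_ he hx
  · have h1 : ∀ y, ENNReal.ofReal (groundState s y * f x) * truncatedKernel s n x y =
        ENNReal.ofReal (f x) * (ENNReal.ofReal (groundState s y) * truncatedKernel s n x y) := by
      intro y
      rw [mul_comm (groundState s y), ENNReal.ofReal_mul (hf0 x), mul_assoc]
    simp only [h1]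
    rw [lintegral_const_mul' _ _ ENNReal.ofReal_ne_top, hh, ← mul_assoc,
      ← ENNReal.ofReal_mul (hf0 x), mul_comm (f x)]
    congr 4; ring
  · intro R x y
    simp [groundState, truncatedKernel_map]
  · intro r hr x y
    rw [truncatedKernel_smul s n hr, rpow_add hr, ENNReal.ofReal_mul (by positivity),
      groundState, norm_smul, norm_of_nonneg hr.le, mul_rpow hr.le (norm_nonneg _),
      ENNReal.ofReal_mul (by positivity), groundState]
    exact mul_mul_mul_comm _ _ _ _

/-- The diagonal products `w(x) f(x)`, for which only the truncated kernel is integrated in `y`. -/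
lemma lintegral_truncatedKernel_diagonal [NeZero d] {s : ℝ} (n : ℕ) {e : 𝔼} (he : ‖e‖ = 1)
    {f : 𝔼 → ℝ} (hf : Measurable f) (hf0 : ∀ x, 0 ≤ f x) :
    ∫⁻ x, ∫⁻ y, ENNReal.ofReal (groundState s x * f x) * truncatedKernel s n x y =
      (∫⁻ y, truncatedKernel s n e y) *
        ∫⁻ x : 𝔼, ENNReal.ofReal (‖x‖ ^ (-((d : ℝ) + 2 * s) / 2) * f x) := by
  have h0 : ∀ᵐ x : 𝔼, x ≠ 0 := by simp [ae_iff]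
  rw [mul_comm, ← lintegral_mul_const _ (by fun_prop)]
  refine lintegral_congr_ae (h0.mono fun x hx => ?_)
  have hx' : 0 < ‖x‖ := norm_pos_iff.2 hx
  have hh := lintegral_of_homogeneous (d := d)
    (F := fun x y => truncatedKernel s n x y) (p := -((d : ℝ) + 2 * s))
    (truncatedKernel_map s n) (fun r hr => truncatedKernel_smul s n hr) he hx
  beta_reduce
  rw [lintegral_const_mul' _ _ ENNReal.ofReal_ne_top, hh, ← mul_assoc,
    ← ENNReal.ofReal_mul (mul_nonneg (groundState_nonneg s x) (hf0 x)), groundState,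
    mul_right_comm, ← rpow_add hx']
  congr 4; ring

lemma lintegral_truncatedKernel_swap {s : ℝ} (n : ℕ) {A : 𝔼 → 𝔼 → ℝ}
    (hA : Measurable (fun p : 𝔼 × 𝔼 => A p.1 p.2)) :
    ∫⁻ x, ∫⁻ y, ENNReal.ofReal (A y x) * truncatedKernel s n x y =
      ∫⁻ x, ∫⁻ y, ENNReal.ofReal (A x y) * truncatedKernel s n x y := by
  have h : Measurable fun p : 𝔼 × 𝔼 =>
      ENNReal.ofReal (A p.1 p.2) * truncatedKernel s n p.1 p.2 :=
    hA.ennreal_ofReal.mul (measurable_truncatedKernel s n)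
  refine Eq.trans ?_ (lintegral_lintegral_swap h.aemeasurable).symm
  exact lintegral_congr fun x => lintegral_congr fun y => by rw [truncatedKernel_comm]

lemma lintegral_truncatedKernel_add {s : ℝ} (n : ℕ) [NeZero d] {A B : 𝔼 → 𝔼 → ℝ}
    (hB : Measurable (fun p : 𝔼 × 𝔼 => B p.1 p.2))
    (hA0 : ∀ x y, x ≠ 0 → y ≠ 0 → 0 ≤ A x y) (hB0 : ∀ x y, 0 ≤ B x y) :
    ∫⁻ x, ∫⁻ y, ENNReal.ofReal (A x y + B x y) * truncatedKernel s n x y =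
      (∫⁻ x, ∫⁻ y, ENNReal.ofReal (A x y) * truncatedKernel s n x y) +
        ∫⁻ x, ∫⁻ y, ENNReal.ofReal (B x y) * truncatedKernel s n x y := by
  have h0 : ∀ᵐ x : 𝔼, x ≠ 0 := by simp [ae_iff]
  have mB : Measurable fun p : 𝔼 × 𝔼 =>
      ENNReal.ofReal (B p.1 p.2) * truncatedKernel s n p.1 p.2 :=
    hB.ennreal_ofReal.mul (measurable_truncatedKernel s n)
  rw [← lintegral_add_right _ mB.lintegral_prod_right']
  refine lintegral_congr_ae (h0.mono fun x hx => ?_)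
  have mB' : Measurable fun y => ENNReal.ofReal (B x y) * truncatedKernel s n x y :=
    mB.comp measurable_prodMk_left
  simp only
  rw [← lintegral_add_right _ mB']
  refine lintegral_congr_ae (h0.mono fun y hy => ?_)
  simp only
  rw [ENNReal.ofReal_add (hA0 x y hx hy) (hB0 x y), add_mul]

/-- Integrating a pointwise identity against a symmetric truncated kernel: both the diagonal and
the off-diagonal products reduce, by homogeneity, to multiples of the single integral
`∫ |x|^(-(d+2s)/2) f(x) dx`. -/
lemma lintegral_truncated_identity [NeZero d] {s : ℝ} (n : ℕ) {e : 𝔼} (he : ‖e‖ = 1)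
    {f : 𝔼 → ℝ} (hf : Measurable f) (hf0 : ∀ x, 0 ≤ f x) {Φ Ψ : 𝔼 → 𝔼 → ℝ}
    (hΦ0 : ∀ x y, x ≠ 0 → y ≠ 0 → 0 ≤ Φ x y) (hΨ0 : ∀ x y, x ≠ 0 → y ≠ 0 → 0 ≤ Ψ x y)
    (hid : ∀ x y, x ≠ 0 → y ≠ 0 →
      Φ x y + (groundState s y * f x + groundState s x * f y) =
        Ψ x y + (groundState s x * f x + groundState s y * f y)) :
    (∫⁻ x, ∫⁻ y, ENNReal.ofReal (Φ x y) * truncatedKernel s n x y) +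
      2 * (∫⁻ y, ENNReal.ofReal (groundState s y) * truncatedKernel s n e y) *
        ∫⁻ x : 𝔼, ENNReal.ofReal (‖x‖ ^ (-((d : ℝ) + 2 * s) / 2) * f x) =
    (∫⁻ x, ∫⁻ y, ENNReal.ofReal (Ψ x y) * truncatedKernel s n x y) +
      2 * (∫⁻ y, truncatedKernel s n e y) *
        ∫⁻ x : 𝔼, ENNReal.ofReal (‖x‖ ^ (-((d : ℝ) + 2 * s) / 2) * f x) := by
  have h0 : ∀ᵐ x : 𝔼, x ≠ 0 := by simp [ae_iff]
  have hg := groundState_nonneg (d := d) s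
  have hX := lintegral_groundState_mul_truncatedKernel (s := s) n he hf hf0
  have hY := lintegral_truncatedKernel_diagonal (s := s) n he hf hf0
  have hX' := lintegral_truncatedKernel_swap (s := s) n
    (A := fun x y => groundState s y * f x) (by fun_prop)
  have hY' := lintegral_truncatedKernel_swap (s := s) n
    (A := fun x y => groundState s x * f x) (by fun_prop)
  rw [hX] at hX'
  rw [hY] at hY'
  have hL := lintegral_truncatedKernel_add (s := s) n (A := Φ)
    (B := fun x y => groundState s y * f x + groundState s x * f y) (by fun_prop) hΦ0
    (fun x y => add_nonneg (mul_nonneg (hg y) (hf0 x)) (mul_nonneg (hg x) (hf0 y)))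
  have hL2 := lintegral_truncatedKernel_add (s := s) n (A := fun x y => groundState s y * f x)
    (B := fun x y => groundState s x * f y) (by fun_prop)
    (fun x y _ _ => mul_nonneg (hg y) (hf0 x)) (fun x y => mul_nonneg (hg x) (hf0 y))
  have hR := lintegral_truncatedKernel_add (s := s) n (A := Ψ)
    (B := fun x y => groundState s x * f x + groundState s y * f y) (by fun_prop) hΨ0
    (fun x y => add_nonneg (mul_nonneg (hg x) (hf0 x)) (mul_nonneg (hg y) (hf0 y)))
  have hR2 := lintegral_truncatedKernel_add (s := s) n (A := fun x y => groundState s x * f x)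
    (B := fun x y => groundState s y * f y) (by fun_prop)
    (fun x y _ _ => mul_nonneg (hg x) (hf0 x)) (fun x y => mul_nonneg (hg y) (hf0 y))
  rw [hL2, hX, hX', ← add_mul, ← two_mul] at hL
  rw [hR2, hY, hY', ← add_mul, ← two_mul] at hR
  rw [← hL, ← hR]
  refine lintegral_congr_ae (h0.mono fun x hx => ?_)
  refine lintegral_congr_ae (h0.mono fun y hy => ?_)
  simp only
  rw [hid x y hx hy]

lemma tendsto_lintegral_truncated [NeZero d] {s : ℝ} (hs0 : 0 < s) {Φ : 𝔼 → 𝔼 → ℝ}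
    (hΦ : Measurable (fun p : 𝔼 × 𝔼 => Φ p.1 p.2)) :
    Tendsto (fun n => ∫⁻ x, ∫⁻ y, ENNReal.ofReal (Φ x y) * truncatedKernel s n x y) atTop
      (𝓝 (∫⁻ x, ∫⁻ y, ENNReal.ofReal (Φ x y * rieszKernel s x y))) := by
  have hK := measurable_truncatedKernel (d := d) s
  have h1 : ∀ n, Measurable fun p : 𝔼 × 𝔼 =>
      ENNReal.ofReal (Φ p.1 p.2) * truncatedKernel s n p.1 p.2 := fun n =>
    hΦ.ennreal_ofReal.mul (hK n)
  have h2 : Measurable fun p : 𝔼 × 𝔼 => ENNReal.ofReal (Φ p.1 p.2 * rieszKernel s p.1 p.2) := by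
    fun_prop
  have := lintegral_tendsto_of_tendsto_of_monotone (μ := (volume : Measure 𝔼).prod volume)
    (f := fun n p => ENNReal.ofReal (Φ p.1 p.2) * truncatedKernel s n p.1 p.2)
    (F := fun p => ENNReal.ofReal (Φ p.1 p.2 * rieszKernel s p.1 p.2))
    (fun n => (h1 n).aemeasurable)
    (.of_forall fun p m n hmn => mul_le_mul_right (truncatedKernel_mono s p.1 p.2 hmn) _)
    (.of_forall fun p => by
      rw [ENNReal.ofReal_mul' (rieszKernel_nonneg s _ _)]
      exact ENNReal.Tendsto.const_mul (tendsto_truncatedKernel hs0 p.1 p.2)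
        (Or.inr ENNReal.ofReal_ne_top))
  rw [lintegral_prod _ h2.aemeasurable] at this
  simpa only [lintegral_prod _ (h1 _).aemeasurable] using this

/-- The ground state representation in `[0, ∞]`: it holds for every measurable function for which
the Hardy integral is finite. -/
theorem gagliardo_eq_groundState_add [NeZero d] {s : ℝ} (hs0 : 0 < s) (hs1 : s < 1)
    (hs : s < (d : ℝ) / 2) {u : 𝔼 → ℂ} (hu : Measurable u)
    (hM : ∫⁻ x, ENNReal.ofReal (hardyDensity s u x) ≠ ⊤) :
    ∫⁻ x, ∫⁻ y, ENNReal.ofReal (‖u x - u y‖ ^ 2 * rieszKernel s x y) =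
      (∫⁻ x, ∫⁻ y, ENNReal.ofReal (groundStateKernel s (groundStateQuotient s u) x y)) +
      ENNReal.ofReal (hardyConst s d * (formConst s d)⁻¹) *
        ∫⁻ x, ENNReal.ofReal (hardyDensity s u x) := by
  have h0 : ∀ᵐ x : 𝔼, x ≠ 0 := by simp [ae_iff]
  have hΓ1 : 0 < Gamma ((d - 2 * s) / 4) := Gamma_pos_of_pos (by linarith)
  have hS := sphereArea_pos (d := d)
  have hC : 0 < hardyConst s d * (formConst s d)⁻¹ :=
    mul_pos (hardyConst_pos hs0 hs) (inv_pos.2 (formConst_pos hs0 hs1))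
  obtain ⟨e, he⟩ : ∃ e : 𝔼, ‖e‖ = 1 := exists_norm_eq 𝔼 zero_le_one
  set v := groundStateQuotient s u with hv
  have hvm : Measurable v := by
    have : v = fun x => ((‖x‖ ^ (((d : ℝ) - 2 * s) / 2) : ℝ) : ℂ) * u x := rfl
    rw [this]; fun_prop
  set f : 𝔼 → ℝ := fun x => ‖x‖ ^ (((d : ℝ) - 2 * s) / 2) * ‖u x‖ ^ 2 with hf
  set Ψ : 𝔼 → 𝔼 → ℝ := fun x y => ‖v x - v y‖ ^ 2 * groundState s x * groundState s y with hΨ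
  have hMf : ∫⁻ x : 𝔼, ENNReal.ofReal (‖x‖ ^ (-((d : ℝ) + 2 * s) / 2) * f x) =
      ∫⁻ x, ENNReal.ofReal (hardyDensity s u x) := by
    refine lintegral_congr_ae (h0.mono fun x hx => ?_)
    have hx' : 0 < ‖x‖ := norm_pos_iff.2 hx
    simp only [hf, hardyDensity]
    rw [← mul_assoc, ← rpow_add hx']
    congr 3; ring
  have hG : ∫⁻ x, ∫⁻ y, ENNReal.ofReal (groundStateKernel s v x y) =
      ∫⁻ x, ∫⁻ y, ENNReal.ofReal (Ψ x y * rieszKernel s x y) := by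
    refine lintegral_congr fun x => lintegral_congr fun y => ?_
    simp only [groundStateKernel, hΨ, groundState, rieszKernel]
    rw [rpow_neg (norm_nonneg (x - y))]
    congr 1; ring
  set E : ℕ → ENNReal := fun n => ∫⁻ x : 𝔼, ∫⁻ y : 𝔼,
    ENNReal.ofReal ((groundState s x - groundState s y) * (exp (-‖x‖ ^ 2) - exp (-‖y‖ ^ 2))) *
      truncatedKernel s n x y with hE
  set m := ∫⁻ x : 𝔼, ENNReal.ofReal (‖x‖ ^ (-((d : ℝ) + 2 * s) / 2) * exp (-‖x‖ ^ 2)) with hm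
  have hmv : m = ENNReal.ofReal (sphereArea d / 2 * Gamma ((d - 2 * s) / 4)) :=
    lintegral_groundState_mul_gaussian hs
  have hm0 : m ≠ 0 := by
    rw [hmv]; simpa using by positivity
  have hmt : m ≠ ⊤ := hmv ▸ ENNReal.ofReal_ne_top
  set M := ∫⁻ x, ENNReal.ofReal (hardyDensity s u x) with hMdef
  have hI : ∀ n : ℕ, ∫⁻ y, ENNReal.ofReal (groundState s y) * truncatedKernel s n e y ≠ ⊤ := by
    intro n
    refine ne_top_of_le_ne_top (b := ENNReal.ofReal (((n : ℝ) + 1) ^ ((d : ℝ) + 2 * s)) *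
      ∫⁻ y : 𝔼, ENNReal.ofReal (groundState s y * (1 + ‖y‖) ^ (-((d : ℝ) + 2 * s)))) ?_ ?_
    · exact ENNReal.mul_ne_top ENNReal.ofReal_ne_top
        (lintegral_groundState_mul_one_add_lt_top hs0 hs).ne
    · rw [← lintegral_const_mul' _ _ ENNReal.ofReal_ne_top]
      refine lintegral_mono fun y => ?_
      rw [ENNReal.ofReal_mul (groundState_nonneg s y), mul_left_comm]
      exact mul_le_mul_right (truncatedKernel_le hs0 n he y) _
  -- `E n / m` is the constant in front of the Hardy integral at truncation `n`: `h1` is the identity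
  -- for the Gaussian, where the whole energy is the cross term, and `h2` is the one for `u`. The
  -- finite off-diagonal part `2 * I * M` cancels from both sides.
  have hfin : ∀ n : ℕ, ∫⁻ x, ∫⁻ y, ENNReal.ofReal (‖u x - u y‖ ^ 2) * truncatedKernel s n x y =
      (∫⁻ x, ∫⁻ y, ENNReal.ofReal (Ψ x y) * truncatedKernel s n x y) + E n / m * M := by
    intro n
    have h1 := lintegral_truncated_identity (s := s) n he (f := fun x : 𝔼 => exp (-‖x‖ ^ 2))
      (Φ := fun x y => (groundState s x - groundState s y) * (exp (-‖x‖ ^ 2) - exp (-‖y‖ ^ 2)))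
      (Ψ := fun _ _ => 0) (by fun_prop) (fun x => (exp_pos _).le)
      (fun x y hx hy => groundState_sub_mul_gaussian_sub_nonneg hs hx hy) (fun _ _ _ _ => le_rfl)
      (fun x y _ _ => by ring)
    have h2 := lintegral_truncated_identity (s := s) n he (f := f)
      (Φ := fun x y => ‖u x - u y‖ ^ 2) (Ψ := Ψ) (by fun_prop)
      (fun x => by simp only [hf]; positivity)
      (fun x y _ _ => by positivity)
      (fun x y _ _ => mul_nonneg (mul_nonneg (by positivity) (groundState_nonneg s x))
        (groundState_nonneg s y)) ?_
    · simp only [ENNReal.ofReal_zero, zero_mul, lintegral_const, zero_add] at h1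
      rw [hMf] at h2
      set I := ∫⁻ y, ENNReal.ofReal (groundState s y) * truncatedKernel s n e y
      set J := ∫⁻ y, truncatedKernel s n e y
      have h3 : 2 * J = E n / m + 2 * I := by
        rw [← ENNReal.mul_left_inj hm0 hmt, ← h1, add_mul, ENNReal.div_mul_cancel hm0 hmt]
      rw [h3, add_mul, ← add_assoc] at h2
      exact (ENNReal.add_left_inj
        (ENNReal.mul_ne_top (ENNReal.mul_ne_top (by simp) (hI n)) hM)).1 h2
    · intro x y hx hy
      have hx' : 0 < ‖x‖ := norm_pos_iff.2 hx
      have hy' : 0 < ‖y‖ := norm_pos_iff.2 hy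
      have hpx : 0 < ‖x‖ ^ (((d : ℝ) - 2 * s) / 2) := by positivity
      have hpy : 0 < ‖y‖ ^ (((d : ℝ) - 2 * s) / 2) := by positivity
      simp only [hΨ, hf, hv, groundStateQuotient, groundState, rpow_neg (norm_nonneg _)]
      generalize ‖x‖ ^ (((d : ℝ) - 2 * s) / 2) = p at *
      generalize ‖y‖ ^ (((d : ℝ) - 2 * s) / 2) = q at *
      simp only [Complex.sq_norm, Complex.normSq_apply]
      simp
      field_simp
      ring
  have hlim1 := tendsto_lintegral_truncated hs0 (Φ := fun x y : 𝔼 => ‖u x - u y‖ ^ 2)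
    (by fun_prop)
  have hlim2 := tendsto_lintegral_truncated hs0 (Φ := Ψ) (by fun_prop)
  have hlim3 := tendsto_lintegral_truncated hs0 (Φ := fun x y : 𝔼 =>
    (groundState s x - groundState s y) * (exp (-‖x‖ ^ 2) - exp (-‖y‖ ^ 2))) (by fun_prop)
  rw [groundState_gaussian_energy hs0 hs1 hs, ENNReal.ofReal_mul hC.le, ← hmv] at hlim3
  have hlim4 := ENNReal.Tendsto.mul_const (ENNReal.Tendsto.div_const hlim3 (Or.inr hm0)) (b := M)
    (Or.inr hM)
  rw [ENNReal.mul_div_cancel_right hm0 hmt] at hlim4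
  simp only [hfin] at hlim1
  rw [hG]
  exact tendsto_nhds_unique hlim1 (hlim2.add hlim4)

/-! ### The Fourier transform of tempered functions -/

lemma fourierHat_eq_fourier (φ : 𝔼 → ℂ) (ξ : 𝔼) :
    fourierHat φ ξ = (((2 * π) ^ (-(d : ℝ) / 2) : ℝ) : ℂ) * 𝓕 φ ((2 * π)⁻¹ • ξ) := by
  rw [fourierHat, Real.fourier_eq']
  congr 1
  refine integral_congr_ae (.of_forall fun x => ?_)
  simp only [smul_eq_mul, inner_smul_right]
  rw [mul_comm (φ x), real_inner_comm]
  congr 2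
  push_cast
  have : (π : ℂ) ≠ 0 := by exact_mod_cast pi_ne_zero
  field_simp

/-- The Fourier transform of a Schwartz function, in the unitary normalization, as a Schwartz
function. -/
lemma exists_schwartz_eq_fourierHat (φ : 𝓢(𝔼, ℂ)) :
    ∃ ψ : 𝓢(𝔼, ℂ), ∀ ξ, ψ ξ = fourierHat φ ξ := by
  have h : (2 * π)⁻¹ ≠ 0 := by have := pi_pos; positivity
  refine ⟨(((2 * π) ^ (-(d : ℝ) / 2) : ℝ) : ℂ) • SchwartzMap.compCLMOfContinuousLinearEquiv ℂ
    (ContinuousLinearEquiv.smulLeft (Units.mk0 _ h)) (𝓕 φ), fun ξ => ?_⟩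
  rw [fourierHat_eq_fourier]
  rfl

lemma hasTemperateGrowth_exp_mul_I :
    Function.HasTemperateGrowth (fun t : ℝ => Complex.exp (Complex.I * t)) := by
  have h : ∀ n : ℕ, iteratedDeriv n (fun t : ℝ => Complex.exp (Complex.I * t)) =
      fun t : ℝ => Complex.I ^ n * Complex.exp (Complex.I * t) := by
    intro n
    induction n with
    | zero => simp
    | succ n ih =>
      rw [iteratedDeriv_succ, ih]
      funext t
      have h1 : HasDerivAt (fun t : ℝ => Complex.I * (t : ℂ)) (Complex.I * 1) t :=
        (Complex.ofRealCLM.hasDerivAt (x := t)).const_mul Complex.I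
      rw [((h1.cexp).const_mul (Complex.I ^ n)).deriv]
      ring
  refine ⟨(contDiff_const.mul Complex.ofRealCLM.contDiff).cexp, fun n => ⟨0, 1, fun t => ?_⟩⟩
  rw [norm_iteratedFDeriv_eq_norm_iteratedDeriv, h]
  simp [mul_comm Complex.I, Complex.norm_exp_ofReal_mul_I]

lemma exists_schwartz_modulation (h : 𝔼) (φ : 𝓢(𝔼, ℂ)) :
    ∃ ψ : 𝓢(𝔼, ℂ), ∀ ξ, ψ ξ = Complex.exp (Complex.I * (inner ℝ h ξ : ℝ)) * φ ξ := by
  have hg : Function.HasTemperateGrowth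
      (fun ξ : 𝔼 => Complex.exp (Complex.I * (inner ℝ h ξ : ℝ))) :=
    hasTemperateGrowth_exp_mul_I.comp (Function.hasTemperateGrowth_inner_right h)
  exact ⟨SchwartzMap.smulLeftCLM ℂ (fun ξ : 𝔼 => Complex.exp (Complex.I * (inner ℝ h ξ : ℝ))) φ,
    fun ξ => by rw [SchwartzMap.smulLeftCLM_apply_apply hg, smul_eq_mul]⟩

/-- The difference `u(x+h) - u(x)` has the Fourier transform `(e^(ih·ξ) - 1) û(ξ)`. -/
lemma HasFourierTransform.difference {u g : 𝔼 → ℂ} (hug : HasFourierTransform u g) (h : 𝔼) :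
    HasFourierTransform (fun x => u (x + h) - u x)
      (fun ξ => (Complex.exp (Complex.I * (inner ℝ h ξ : ℝ)) - 1) * g ξ) := by
  obtain ⟨hu, hg, H⟩ := hug
  have hmp : MeasurePreserving (fun x : 𝔼 => x + h) := measurePreserving_add_right _ h
  refine ⟨(hu.comp_measurePreserving hmp).sub hu, ?_, fun φ => ?_⟩
  · exact (by fun_prop : Continuous fun ξ : 𝔼 =>
      Complex.exp (Complex.I * (inner ℝ h ξ : ℝ)) - 1).aestronglyMeasurable.mul hg
  · obtain ⟨ψ, hψ⟩ := exists_schwartz_modulation h φ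
    have hhat : ∀ x, fourierHat ψ (x + h) = fourierHat φ x := by
      intro x
      simp only [fourierHat]
      congr 1
      refine integral_congr_ae (.of_forall fun y => ?_)
      simp only [hψ]
      rw [mul_comm (Complex.exp _), mul_assoc, ← Complex.exp_add, inner_add_left]
      congr 2
      push_cast; ring
    obtain ⟨i1, i2, e1⟩ := H φ
    obtain ⟨j1, j2, e2⟩ := H ψ
    have k1 : Integrable fun x => u (x + h) * fourierHat φ x := by
      simpa only [hhat] using j1.comp_add_right h
    have e3 : ∫ x, u (x + h) * fourierHat φ x = ∫ ξ, g ξ * ψ ξ := by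
      rw [← e2, ← integral_add_right_eq_self (fun x => u x * fourierHat ψ x) h]
      simp only [hhat]
    have f1 : (fun x => (u (x + h) - u x) * fourierHat φ x) =
        fun x => u (x + h) * fourierHat φ x - u x * fourierHat φ x := by
      funext x; ring
    have f2 : (fun ξ => (Complex.exp (Complex.I * (inner ℝ h ξ : ℝ)) - 1) * g ξ * φ ξ) =
        fun ξ => g ξ * ψ ξ - g ξ * φ ξ := by
      funext ξ; rw [hψ]; ring
    rw [f1, f2]
    exact ⟨k1.sub i1, j2.sub i2, by rw [integral_sub k1 i1, integral_sub j2 i2, e3, e1]⟩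

lemma lintegral_enorm_sq_eq_eLpNorm_sq (f : 𝔼 → ℂ) :
    ∫⁻ x, ‖f x‖ₑ ^ 2 = eLpNorm f 2 volume ^ 2 := by
  have := eLpNorm_nnreal_pow_eq_lintegral (f := f) (μ := volume) (p := 2) (by simp)
  norm_num at this
  exact this.symm

/-- Testing against a bump function that is `1` near a given point. -/
lemma locallyIntegrable_of_forall_schwartz {V : 𝔼 → ℂ}
    (hV : ∀ ψ : 𝓢(𝔼, ℂ), Integrable fun x => V x * ψ x) : LocallyIntegrable V := by
  intro x
  let b : ContDiffBump x := ⟨1, 2, one_pos, one_lt_two⟩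
  have hb1 : HasCompactSupport (Complex.ofRealCLM ∘ b) := b.hasCompactSupport.comp_left rfl
  have hb2 : ContDiff ℝ ∞ (Complex.ofRealCLM ∘ b) := Complex.ofRealCLM.contDiff.comp b.contDiff
  refine ⟨Metric.closedBall x 1, Metric.closedBall_mem_nhds x one_pos, ?_⟩
  refine ((hV (hb1.toSchwartzMap hb2)).integrableOn (s := Metric.closedBall x 1)).congr_fun
    (fun y hy => ?_) Metric.isClosed_closedBall.measurableSet
  have : b y = 1 := b.one_of_mem_closedBall hy
  simp [this]

/-- Plancherel's theorem for a tempered function whose Fourier transform is square integrable. The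
rescaling `V(y) = (2π)^(d/2) U(2πy)` passes to the normalization `∫ f(x) e^(-2πi ξ·x) dx`. -/
lemma HasFourierTransform.plancherel {U G : 𝔼 → ℂ} (h : HasFourierTransform U G)
    (hG : ∫⁻ ξ, ‖G ξ‖ₑ ^ 2 ≠ ⊤) : ∫⁻ x, ‖U x‖ₑ ^ 2 = ∫⁻ ξ, ‖G ξ‖ₑ ^ 2 := by
  obtain ⟨hUm, hGm, H⟩ := h
  have hc : 0 < 2 * π := two_pi_pos
  have hGL : MemLp G 2 := by
    refine ⟨hGm, ?_⟩
    rw [lintegral_enorm_sq_eq_eLpNorm_sq] at hG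
    exact lt_top_iff_ne_top.2 fun h => hG (by rw [h]; rfl)
  set A : ℝ := (2 * π) ^ ((d : ℝ) / 2) with hA
  have hApos : 0 < A := by positivity
  set V : 𝔼 → ℂ := fun y => (A : ℂ) * U ((2 * π) • y) with hV
  have hVψ : ∀ φ : 𝓢(𝔼, ℂ), Integrable (fun y => V y * (𝓕 φ : 𝓢(𝔼, ℂ)) y) ∧
      ∫ y, V y * (𝓕 φ : 𝓢(𝔼, ℂ)) y = ∫ ξ, G ξ * φ ξ := by
    intro φ
    obtain ⟨i1, -, e1⟩ := H φ
    have hfun : ∀ y : 𝔼, V y * (𝓕 φ : 𝓢(𝔼, ℂ)) y = ((A ^ 2 : ℝ) : ℂ) *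
        (U ((2 * π) • y) * fourierHat φ ((2 * π) • y)) := by
      intro y
      have hAA : (2 * π) ^ (-(d : ℝ) / 2) = A⁻¹ := by
        rw [hA, neg_div, rpow_neg hc.le]
      rw [fourierHat_eq_fourier, smul_smul, inv_mul_cancel₀ hc.ne', one_smul, hAA,
        SchwartzMap.fourier_coe]
      have : (A : ℂ) ≠ 0 := by exact_mod_cast hApos.ne'
      simp only [hV]
      push_cast
      field_simp
    simp_rw [hfun]
    refine ⟨(i1.comp_smul hc.ne').const_mul _, ?_⟩
    rw [integral_const_mul, Measure.integral_comp_smul volume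
      (fun x => U x * fourierHat φ x), e1, finrank_euclideanSpace_fin,
      abs_of_pos (by positivity), Complex.real_smul, ← mul_assoc, ← Complex.ofReal_mul]
    have : A ^ 2 * ((2 * π) ^ d)⁻¹ = 1 := by
      rw [hA, ← rpow_natCast _ 2, ← rpow_mul hc.le, ← rpow_natCast _ d]
      push_cast
      rw [div_mul_cancel₀ _ two_ne_zero, mul_inv_cancel₀ (by positivity)]
    rw [this]; simp
  set Gp : Lp ℂ 2 (volume : Measure 𝔼) := hGL.toLp G with hGp
  set V' : Lp ℂ 2 (volume : Measure 𝔼) := 𝓕⁻ Gp with hV'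
  have hFV : 𝓕 V' = Gp := fourier_fourierInv_eq Gp
  have hV'ψ : ∀ φ : 𝓢(𝔼, ℂ), ∫ y, (𝓕 φ : 𝓢(𝔼, ℂ)) y * V' y = ∫ ξ, G ξ * φ ξ := by
    intro φ
    have h1 := Lp.fourier_toTemperedDistribution_eq V'
    have h2 := congrArg (fun T : 𝓢'(𝔼, ℂ) => T φ) h1
    simp only [TemperedDistribution.fourier_apply, Lp.toTemperedDistribution_apply, hFV,
      smul_eq_mul] at h2
    rw [h2]
    refine integral_congr_ae ?_
    filter_upwards [hGL.coeFn_toLp] with ξ hξ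
    rw [hξ, mul_comm]
  have hVS : ∀ ψ : 𝓢(𝔼, ℂ), Integrable fun x => V x * ψ x := by
    intro ψ
    have := (hVψ (𝓕⁻ ψ)).1
    rwa [fourier_fourierInv_eq] at this
  -- `V` is not known to be square integrable; it is locally integrable and defines the same
  -- distribution as the `L²` inverse Fourier transform `V'` of `G`.
  have hae : ∀ᵐ y, V y = V' y := by
    refine ae_eq_of_integral_contDiff_smul_eq (locallyIntegrable_of_forall_schwartz hVS)
      ((Lp.memLp V').locallyIntegrable (by norm_num)) fun g hg1 hg2 => ?_
    have hb1 : HasCompactSupport (Complex.ofRealCLM ∘ g) := hg2.comp_left rfl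
    have hb2 : ContDiff ℝ ∞ (Complex.ofRealCLM ∘ g) := Complex.ofRealCLM.contDiff.comp hg1
    have h1 := (hVψ (𝓕⁻ (hb1.toSchwartzMap hb2))).2
    have h2 := hV'ψ (𝓕⁻ (hb1.toSchwartzMap hb2))
    rw [fourier_fourierInv_eq] at h1 h2
    rw [← h1] at h2
    simpa [mul_comm] using h2.symm
  have hnorm : ∫⁻ y, ‖V y‖ₑ ^ 2 = ∫⁻ ξ, ‖G ξ‖ₑ ^ 2 := by
    have h1 : ‖V'‖ = ‖Gp‖ := by rw [← hFV, Lp.norm_fourier_eq]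
    rw [Lp.norm_def, Lp.norm_def, ENNReal.toReal_eq_toReal_iff' (Lp.eLpNorm_ne_top _)
      (Lp.eLpNorm_ne_top _)] at h1
    rw [lintegral_enorm_sq_eq_eLpNorm_sq, lintegral_enorm_sq_eq_eLpNorm_sq,
      eLpNorm_congr_ae hae, h1, eLpNorm_congr_ae hGL.coeFn_toLp]
  rw [← hnorm, lintegral_comp_smul_of_pos _ hc, ← lintegral_const_mul' _ _ ENNReal.ofReal_ne_top]
  refine lintegral_congr fun y => ?_
  have hA2 : (2 * π) ^ (d : ℝ) = A ^ 2 := by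
    rw [hA, ← rpow_natCast _ 2, ← rpow_mul hc.le]
    push_cast
    rw [div_mul_cancel₀ _ two_ne_zero]
  simp only [hV, enorm_mul, mul_pow]
  rw [hA2, ENNReal.ofReal_pow hApos.le]
  congr 2
  rw [← ofReal_norm, Complex.norm_real, norm_of_nonneg hApos.le]

lemma norm_exp_sub_one_sq (t : ℝ) : ‖Complex.exp (Complex.I * t) - 1‖ ^ 2 = 2 - 2 * cos t := by
  rw [Complex.sq_norm, Complex.normSq_apply, mul_comm Complex.I, Complex.exp_mul_I]
  simp only [Complex.sub_re, Complex.add_re, Complex.mul_re, Complex.I_re, Complex.I_im,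
    Complex.sub_im, Complex.add_im, Complex.mul_im, Complex.one_re, Complex.one_im,
    ← Complex.ofReal_cos, ← Complex.ofReal_sin, Complex.ofReal_re, Complex.ofReal_im]
  nlinarith [sin_sq_add_cos_sq t]

lemma ofReal_norm_sq (z : ℂ) : ENNReal.ofReal (‖z‖ ^ 2) = ‖z‖ₑ ^ 2 := by
  rw [ENNReal.ofReal_pow (norm_nonneg _), ofReal_norm]

/-- The kinetic energy as a Gagliardo seminorm, by Plancherel's theorem for the differences
`u(x+h) - u(x)`. The function `u` itself need not be square integrable. -/
theorem HasFourierTransform.gagliardo_eq [NeZero d] {s : ℝ} (hs0 : 0 < s) (hs1 : s < 1)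
    {u g : 𝔼 → ℂ} (hum : Measurable u) (hgm : Measurable g) (hug : HasFourierTransform u g)
    (hT : ∫⁻ ξ, ENNReal.ofReal (kineticDensity s g ξ) ≠ ⊤) :
    ∫⁻ x, ∫⁻ y, ENNReal.ofReal (‖u x - u y‖ ^ 2 * rieszKernel s x y) =
      ENNReal.ofReal (formConst s d)⁻¹ * ∫⁻ ξ, ENNReal.ofReal (kineticDensity s g ξ) := by
  have hd : 0 < (d : ℝ) := by exact_mod_cast Nat.pos_of_ne_zero (NeZero.ne d)
  have h0 : ∀ᵐ x : 𝔼, x ≠ 0 := by simp [ae_iff]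
  have ha := formConst_pos (d := d) hs0 hs1
  have hcos : ∀ t, 0 ≤ 2 - 2 * cos t := fun t => by linarith [cos_le_one t]
  set R : 𝔼 → ENNReal := fun h =>
    ∫⁻ ξ : 𝔼, ENNReal.ofReal ((2 - 2 * cos (inner ℝ h ξ)) * ‖g ξ‖ ^ 2) with hR
  have hRm : Measurable fun p : 𝔼 × 𝔼 =>
      ENNReal.ofReal ((2 - 2 * cos (inner ℝ p.1 p.2)) * ‖g p.2‖ ^ 2) := by fun_prop
  have hRmeas : Measurable R := hRm.lintegral_prod_right'
  have hRint : ∫⁻ h : 𝔼, R h * ENNReal.ofReal (‖h‖ ^ (-((d : ℝ) + 2 * s))) =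
      ENNReal.ofReal (formConst s d)⁻¹ * ∫⁻ ξ, ENNReal.ofReal (kineticDensity s g ξ) := by
    simp_rw [hR, ← lintegral_mul_const' _ _ ENNReal.ofReal_ne_top]
    rw [lintegral_lintegral_swap (by fun_prop), ← lintegral_const_mul' _ _ ENNReal.ofReal_ne_top]
    refine lintegral_congr fun ξ => ?_
    have h1 : ∀ h : 𝔼, ENNReal.ofReal ((2 - 2 * cos (inner ℝ h ξ)) * ‖g ξ‖ ^ 2) *
        ENNReal.ofReal (‖h‖ ^ (-((d : ℝ) + 2 * s))) = ENNReal.ofReal (‖g ξ‖ ^ 2) *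
        ENNReal.ofReal ((2 - 2 * cos (inner ℝ h ξ)) * ‖h‖ ^ (-((d : ℝ) + 2 * s))) := by
      intro h
      rw [← ENNReal.ofReal_mul' (by positivity), ← ENNReal.ofReal_mul (by positivity)]
      congr 1; ring
    simp_rw [h1]
    rw [lintegral_const_mul' _ _ ENNReal.ofReal_ne_top, lintegral_one_sub_cos_mul_rpow hs0 hs1,
      ← ENNReal.ofReal_mul (by positivity), ← ENNReal.ofReal_mul (by positivity), kineticDensity]
    congr 1; ring
  have hRtop : ∀ᵐ h : 𝔼, R h * ENNReal.ofReal (‖h‖ ^ (-((d : ℝ) + 2 * s))) < ⊤ := by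
    refine ae_lt_top (hRmeas.mul (by fun_prop)) ?_
    rw [hRint]
    exact ENNReal.mul_ne_top ENNReal.ofReal_ne_top hT
  rw [lintegral_lintegral_shift _ (by fun_prop), ← hRint]
  refine lintegral_congr_ae ?_
  filter_upwards [hRtop, h0] with h hh hh0
  have hh' : 0 < ‖h‖ := norm_pos_iff.2 hh0
  have hRh : R h ≠ ⊤ := by
    intro htop
    rw [htop, ENNReal.top_mul (by simpa using by positivity)] at hh
    exact hh.ne rfl
  have hker : ∀ x : 𝔼, rieszKernel s x (x + h) = ‖h‖ ^ (-((d : ℝ) + 2 * s)) := by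
    intro x; simp [rieszKernel]
  simp_rw [hker]
  simp_rw [ENNReal.ofReal_mul (sq_nonneg _)]
  rw [lintegral_mul_const' _ _ ENNReal.ofReal_ne_top]
  congr 1
  have hRe : R h = ∫⁻ ξ, ‖(Complex.exp (Complex.I * (inner ℝ h ξ : ℝ)) - 1) * g ξ‖ₑ ^ 2 := by
    refine lintegral_congr fun ξ => ?_
    rw [← norm_exp_sub_one_sq, ← mul_pow, ← norm_mul, ofReal_norm_sq]
  rw [hRe] at hRh ⊢
  rw [← (hug.difference h).plancherel hRh]
  refine lintegral_congr fun x => ?_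
  rw [ofReal_norm_sq, ← enorm_neg, neg_sub]

/-! ### Test functions -/

lemma IsTestFunction.exists_schwartz {u : 𝔼 → ℂ} (hu : IsTestFunction u) :
    ∃ φ : 𝓢(𝔼, ℂ), ⇑φ = u := ⟨hu.2.toSchwartzMap hu.1, rfl⟩

lemma IsTestFunction.hasFourierTransform {u : 𝔼 → ℂ} (hu : IsTestFunction u) :
    HasFourierTransform u (fourierHat u) := by
  obtain ⟨v, rfl⟩ := hu.exists_schwartz
  obtain ⟨w, hw⟩ := exists_schwartz_eq_fourierHat v
  have hw' : fourierHat v = w := funext fun ξ => (hw ξ).symm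
  have hmul : ∀ a b : 𝓢(𝔼, ℂ), Integrable fun x => a x * b x := fun a b =>
    b.integrable.bdd_mul a.continuous.aestronglyMeasurable
      (.of_forall fun x => SchwartzMap.norm_le_seminorm ℝ a x)
  refine ⟨v.continuous.aestronglyMeasurable, hw' ▸ w.continuous.aestronglyMeasurable, fun φ => ?_⟩
  obtain ⟨ψ, hψ⟩ := exists_schwartz_eq_fourierHat φ
  have hψ' : fourierHat φ = ψ := funext fun ξ => (hψ ξ).symm
  refine ⟨hψ' ▸ hmul v ψ, hw' ▸ hmul w φ, ?_⟩
  have key := VectorFourier.integral_fourierIntegral_smul_eq_flip (e := Real.fourierChar)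
    (μ := (volume : Measure 𝔼)) (ν := (volume : Measure 𝔼)) (L := (2 * π)⁻¹ • innerₗ 𝔼) (f := v)
    (g := φ) Real.continuous_fourierChar
    (by simp only [LinearMap.smul_apply, innerₗ_apply_apply]; fun_prop) v.integrable φ.integrable
  have hF : ∀ (f : 𝔼 → ℂ) (ξ : 𝔼), VectorFourier.fourierIntegral Real.fourierChar volume
      ((2 * π)⁻¹ • innerₗ 𝔼) f ξ =
      ∫ x, f x * Complex.exp (-(Complex.I * ((inner ℝ ξ x : ℝ) : ℂ))) := by
    intro f ξ
    refine integral_congr_ae (.of_forall fun x => ?_)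
    simp only [LinearMap.smul_apply, innerₗ_apply_apply, Circle.smul_def, Real.fourierChar_apply,
      smul_eq_mul]
    rw [mul_comm (f x), real_inner_comm]
    congr 2
    push_cast
    have : (π : ℂ) ≠ 0 := by exact_mod_cast pi_ne_zero
    field_simp
  have hflip : ((2 * π)⁻¹ • innerₗ 𝔼).flip = (2 * π)⁻¹ • innerₗ 𝔼 := by
    ext x y
    simp [real_inner_comm]
  rw [hflip] at key
  simp only [hF, smul_eq_mul] at key
  simp only [fourierHat, mul_assoc, mul_left_comm (v _)]
  rw [integral_const_mul, integral_const_mul, key]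

lemma IsTestFunction.integrable_kineticDensity {s : ℝ} (hs0 : 0 < s) (hs1 : s < 1) {u : 𝔼 → ℂ}
    (hu : IsTestFunction u) : Integrable (kineticDensity s (fourierHat u)) := by
  obtain ⟨v, rfl⟩ := hu.exists_schwartz
  obtain ⟨w, hw⟩ := exists_schwartz_eq_fourierHat v
  have hw' : fourierHat v = w := funext fun ξ => (hw ξ).symm
  rw [hw']
  set C := SchwartzMap.seminorm ℝ 0 0 w with hC
  have hCw : ∀ ξ, ‖w ξ‖ ≤ C := SchwartzMap.norm_le_seminorm ℝ w
  have h1 := ((w.integrable_pow_mul volume 0).add (w.integrable_pow_mul volume 2)).const_mul C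
  refine h1.mono' ?_ (.of_forall fun ξ => ?_)
  · refine Measurable.aestronglyMeasurable ?_
    have := w.continuous.measurable
    unfold kineticDensity; fun_prop
  · have hp : ‖ξ‖ ^ (2 * s) ≤ 1 + ‖ξ‖ ^ 2 := by
      rcases le_total ‖ξ‖ 1 with h | h
      · have := rpow_le_one (norm_nonneg ξ) h (by linarith : 0 ≤ 2 * s)
        nlinarith [norm_nonneg ξ]
      · have := rpow_le_rpow_of_exponent_le h (by linarith : 2 * s ≤ 2)
        rw [rpow_two] at this
        linarith
    have h0 : 0 ≤ kineticDensity s w ξ := by unfold kineticDensity; positivity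
    rw [norm_of_nonneg h0, kineticDensity]
    simp only [Pi.add_apply, pow_zero, one_mul]
    calc ‖ξ‖ ^ (2 * s) * ‖w ξ‖ ^ 2 ≤ (1 + ‖ξ‖ ^ 2) * (‖w ξ‖ * C) := by
          rw [sq ‖w ξ‖]
          gcongr
          exact hCw ξ
      _ = C * (‖w ξ‖ + ‖ξ‖ ^ 2 * ‖w ξ‖) := by ring

lemma IsTestFunction.lintegral_hardyDensity_lt_top [NeZero d] {s : ℝ} (hs : s < (d : ℝ) / 2)
    {u : 𝔼 → ℂ} (hu : IsTestFunction u) :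
    ∫⁻ x, ENNReal.ofReal (hardyDensity s u x) < ⊤ := by
  obtain ⟨C, hC⟩ := hu.1.continuous.bounded_above_of_compact_support hu.2
  obtain ⟨R, hR0, hR⟩ : ∃ R, 0 < R ∧ ∀ x, u x ≠ 0 → ‖x‖ ≤ R := by
    obtain ⟨R, hR⟩ := hu.2.isBounded.exists_pos_norm_le
    exact ⟨R, hR.1, fun x hx => hR.2 x (subset_tsupport _ hx)⟩
  -- On the support `1 ≤ exp(R²) exp(-|x|²)`, so Gaussian moments dominate.
  have hb : ∀ x, ENNReal.ofReal (hardyDensity s u x) ≤ ENNReal.ofReal (C ^ 2 * exp (R ^ 2)) *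
      ENNReal.ofReal (‖x‖ ^ (-(2 * s)) * exp (-(1 * ‖x‖ ^ 2))) := by
    intro x
    rw [← ENNReal.ofReal_mul (by positivity)]
    refine ENNReal.ofReal_le_ofReal ?_
    unfold hardyDensity
    by_cases hx : u x = 0
    · rw [hx]; simp; positivity
    · have h1 : 1 ≤ exp (R ^ 2) * exp (-(1 * ‖x‖ ^ 2)) := by
        rw [← exp_add]
        refine one_le_exp ?_
        nlinarith [hR x hx, norm_nonneg x]
      calc ‖x‖ ^ (-(2 * s)) * ‖u x‖ ^ 2 ≤ ‖x‖ ^ (-(2 * s)) * C ^ 2 := by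
            gcongr; exact hC x
        _ ≤ ‖x‖ ^ (-(2 * s)) * C ^ 2 * (exp (R ^ 2) * exp (-(1 * ‖x‖ ^ 2))) :=
            le_mul_of_one_le_right (by positivity) h1
        _ = _ := by ring
  refine (lintegral_mono hb).trans_lt ?_
  rw [lintegral_const_mul' _ _ ENNReal.ofReal_ne_top,
    lintegral_rpow_norm_mul_gaussian (by linarith) one_pos]
  exact ENNReal.mul_lt_top ENNReal.ofReal_lt_top ENNReal.ofReal_lt_top

/-! ### The ground state representation and its strict positivity -/

lemma hardyDensity_nonneg (s : ℝ) (u : 𝔼 → ℂ) (x : 𝔼) : 0 ≤ hardyDensity s u x := by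
  unfold hardyDensity; positivity

lemma kineticDensity_nonneg (s : ℝ) (g : 𝔼 → ℂ) (ξ : 𝔼) : 0 ≤ kineticDensity s g ξ := by
  unfold kineticDensity; positivity

lemma groundStateKernel_nonneg (s : ℝ) (v : 𝔼 → ℂ) (x y : 𝔼) : 0 ≤ groundStateKernel s v x y := by
  unfold groundStateKernel; positivity

lemma measurable_groundStateKernel {s : ℝ} {u : 𝔼 → ℂ} (hu : Measurable u) :
    Measurable fun p : 𝔼 × 𝔼 => groundStateKernel s (groundStateQuotient s u) p.1 p.2 := by
  have hv : Measurable (groundStateQuotient s u) := by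
    have : groundStateQuotient s u =
        fun x => ((‖x‖ ^ (((d : ℝ) - 2 * s) / 2) : ℝ) : ℂ) * u x := rfl
    rw [this]; fun_prop
  unfold groundStateKernel; fun_prop

/-- The energy `∬ |v(x) - v(y)|² |x-y|^(-(d+2s)) |x|^(-(d-2s)/2) |y|^(-(d-2s)/2) dx dy` of
`v = |x|^((d-2s)/2) u` as an element of `[0, ∞]`. -/
noncomputable def groundStateEnergy (s : ℝ) (u : 𝔼 → ℂ) : ENNReal :=
  ∫⁻ x, ∫⁻ y, ENNReal.ofReal (groundStateKernel s (groundStateQuotient s u) x y)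

/-- The ground state representation for all `u` with finite kinetic energy and finite Hardy
integral. -/
theorem HasFourierTransform.groundState_representation [NeZero d] {s : ℝ} (hs0 : 0 < s)
    (hs1 : s < 1) (hs : s < (d : ℝ) / 2) {u g : 𝔼 → ℂ} (hum : Measurable u) (hgm : Measurable g)
    (hug : HasFourierTransform u g) (hM : Integrable (hardyDensity s u))
    (hT : Integrable (kineticDensity s g)) :
    groundStateEnergy s u ≠ ⊤ ∧
      (∫ ξ, kineticDensity s g ξ) - hardyConst s d * ∫ x, hardyDensity s u x =
        formConst s d * (groundStateEnergy s u).toReal := by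
  have ha := formConst_pos (d := d) hs0 hs1
  have hC := hardyConst_pos (d := d) hs0 hs
  have hMr := ofReal_integral_eq_lintegral_ofReal hM (.of_forall (hardyDensity_nonneg s u))
  have hTr := ofReal_integral_eq_lintegral_ofReal hT (.of_forall (kineticDensity_nonneg s g))
  have hM0 : 0 ≤ ∫ x, hardyDensity s u x := integral_nonneg (hardyDensity_nonneg s u)
  have hT0 : 0 ≤ ∫ ξ, kineticDensity s g ξ := integral_nonneg (kineticDensity_nonneg s g)
  have h1 := hug.gagliardo_eq hs0 hs1 hum hgm (hTr ▸ ENNReal.ofReal_ne_top)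
  have h2 := gagliardo_eq_groundState_add hs0 hs1 hs hum (hMr ▸ ENNReal.ofReal_ne_top)
  rw [h1, ← hMr, ← hTr, ← ENNReal.ofReal_mul (by positivity), ← ENNReal.ofReal_mul (by positivity)]
    at h2
  change _ = groundStateEnergy s u + _ at h2
  have hfin : groundStateEnergy s u ≠ ⊤ := fun h => by simp [h] at h2
  refine ⟨hfin, ?_⟩
  have h3 := congrArg ENNReal.toReal h2
  rw [ENNReal.toReal_add hfin ENNReal.ofReal_ne_top, ENNReal.toReal_ofReal (by positivity),
    ENNReal.toReal_ofReal (by positivity)] at h3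
  field_simp at h3
  linarith

lemma integrable_groundStateKernel {s : ℝ} {u : 𝔼 → ℂ} (hum : Measurable u)
    (h : groundStateEnergy s u ≠ ⊤) :
    Integrable (fun p : 𝔼 × 𝔼 => groundStateKernel s (groundStateQuotient s u) p.1 p.2)
      (volume.prod volume) ∧
    ∫ x, ∫ y, groundStateKernel s (groundStateQuotient s u) x y =
      (groundStateEnergy s u).toReal := by
  have hm := measurable_groundStateKernel (s := s) hum
  have hl : ∫⁻ p : 𝔼 × 𝔼, ENNReal.ofReal (groundStateKernel s (groundStateQuotient s u) p.1 p.2)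
      ∂(volume.prod volume) = groundStateEnergy s u :=
    lintegral_prod _ hm.ennreal_ofReal.aemeasurable
  have hi : Integrable (fun p : 𝔼 × 𝔼 => groundStateKernel s (groundStateQuotient s u) p.1 p.2)
      (volume.prod volume) := by
    refine ⟨hm.aestronglyMeasurable, ?_⟩
    rw [hasFiniteIntegral_iff_ofReal (.of_forall fun p => groundStateKernel_nonneg s _ _ _), hl]
    exact h.lt_top
  refine ⟨hi, ?_⟩
  rw [← integral_prod (fun p : 𝔼 × 𝔼 => groundStateKernel s (groundStateQuotient s u) p.1 p.2) hi,
    integral_eq_lintegral_of_nonneg_ae (.of_forall fun p => groundStateKernel_nonneg s _ _ _)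
      hm.aestronglyMeasurable, hl]

/-- The logarithmic divergence behind the strict inequality. -/
lemma lintegral_rpow_neg_dim [NeZero d] : ∫⁻ x : 𝔼, ENNReal.ofReal (‖x‖ ^ (-(d : ℝ))) = ⊤ := by
  have hd1 : 1 ≤ d := Nat.pos_of_ne_zero (NeZero.ne d)
  have hS := sphereArea_pos (d := d)
  rw [lintegral_radial (f := fun r => ENNReal.ofReal (r ^ (-(d : ℝ)))) (by fun_prop)]
  have h1 : ∫⁻ r in Ioi (0 : ℝ), ENNReal.ofReal (r ^ (d - 1)) * ENNReal.ofReal (r ^ (-(d : ℝ))) =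
      ∫⁻ r in Ioi (0 : ℝ), ENNReal.ofReal r⁻¹ := by
    refine setLIntegral_congr_fun measurableSet_Ioi fun r hr => ?_
    have hr : 0 < r := hr
    rw [← ENNReal.ofReal_mul (by positivity), ← rpow_natCast r (d - 1), ← rpow_add hr,
      ← rpow_neg_one]
    push_cast [hd1]
    congr 2; ring
  have h2 : ∫⁻ r in Ioi (0 : ℝ), ENNReal.ofReal r⁻¹ = ⊤ := by
    by_contra hne
    refine not_integrableOn_Ioi_inv (a := 0) ⟨by fun_prop, ?_⟩
    rw [hasFiniteIntegral_iff_ofReal]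
    · exact lt_top_iff_ne_top.2 hne
    · refine (ae_restrict_iff' measurableSet_Ioi).2 (.of_forall fun t ht => ?_)
      have : 0 < t := ht
      positivity
  rw [h1, h2, ENNReal.mul_top (by simpa using hS)]

/-- The ground state energy vanishes only for multiples of `|x|^(-(d-2s)/2)`, whose Hardy integral
is infinite. -/
lemma groundStateEnergy_ne_zero [NeZero d] {s : ℝ} {u : 𝔼 → ℂ} (hum : Measurable u)
    (hM : ∫⁻ x, ENNReal.ofReal (hardyDensity s u x) ≠ ⊤) (hu0 : ¬ u =ᵐ[volume] 0) :
    groundStateEnergy s u ≠ 0 := by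
  intro h
  have h0 : ∀ᵐ x : 𝔼, x ≠ 0 := by simp [ae_iff]
  set v := groundStateQuotient s u with hv
  have hm := (measurable_groundStateKernel (s := s) hum).ennreal_ofReal
  rw [groundStateEnergy, lintegral_eq_zero_iff hm.lintegral_prod_right'] at h
  obtain ⟨x, hx, hx0⟩ := (h.and h0).exists
  have hx2 : ∀ᵐ y, ENNReal.ofReal (groundStateKernel s v x y) = 0 :=
    (lintegral_eq_zero_iff (hm.comp measurable_prodMk_left)).1 hx
  have hxy : ∀ᵐ y : 𝔼, y ≠ x := by simp [ae_iff]
  have hconst : ∀ᵐ y, v y = v x := by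
    filter_upwards [hx2, h0, hxy] with y hy hy0 hyx
    have hpx : 0 < ‖x‖ := norm_pos_iff.2 hx0
    have hpy : 0 < ‖y‖ := norm_pos_iff.2 hy0
    have hpxy : 0 < ‖x - y‖ := norm_pos_iff.2 (sub_ne_zero.2 hyx.symm)
    by_contra hne
    have hpv : 0 < ‖v x - v y‖ := norm_pos_iff.2 (sub_ne_zero.2 (Ne.symm hne))
    have : 0 < groundStateKernel s v x y := by unfold groundStateKernel; positivity
    exact this.not_ge (ENNReal.ofReal_eq_zero.1 hy)
  by_cases hc : v x = 0
  · refine hu0 ?_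
    filter_upwards [hconst, h0] with y hy hy0
    have hpy : 0 < ‖y‖ := norm_pos_iff.2 hy0
    rw [hc, hv, groundStateQuotient] at hy
    rcases mul_eq_zero.1 hy with h1 | h1
    · have : 0 < ‖y‖ ^ (((d : ℝ) - 2 * s) / 2) := by positivity
      exact absurd (by exact_mod_cast h1) this.ne'
    · exact h1
  · refine hM ?_
    have hval : ∫⁻ y, ENNReal.ofReal (hardyDensity s u y) =
        ENNReal.ofReal (‖v x‖ ^ 2) * ∫⁻ y : 𝔼, ENNReal.ofReal (‖y‖ ^ (-(d : ℝ))) := by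
      rw [← lintegral_const_mul' _ _ ENNReal.ofReal_ne_top]
      refine lintegral_congr_ae ?_
      filter_upwards [hconst, h0] with y hy hy0
      have hpy : 0 < ‖y‖ := norm_pos_iff.2 hy0
      rw [← hy, ← ENNReal.ofReal_mul (by positivity), hv, groundStateQuotient, norm_mul,
        Complex.norm_real, norm_of_nonneg (by positivity), mul_pow, hardyDensity,
        ← rpow_natCast (‖y‖ ^ _) 2, ← rpow_mul hpy.le, mul_right_comm, ← rpow_add hpy]
      congr 3
      push_cast; ring
    rw [hval, lintegral_rpow_neg_dim, ENNReal.mul_top]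
    simpa using hc

/-! ### Near-optimizers: logarithmic cut-offs of the ground state -/

lemma lintegral_shell [NeZero d] {R : ℝ} (hR : 0 < R) :
    ∫⁻ x : 𝔼, (Icc (exp (-R)) (exp R)).indicator (fun r => ENNReal.ofReal (r ^ (-(d : ℝ)))) ‖x‖ =
      ENNReal.ofReal (sphereArea d * (2 * R)) := by
  have hd1 : 1 ≤ d := Nat.pos_of_ne_zero (NeZero.ne d)
  rw [lintegral_radial (Measurable.indicator (by fun_prop) measurableSet_Icc)]
  have h1 : ∀ r, ENNReal.ofReal (r ^ (d - 1)) *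
      (Icc (exp (-R)) (exp R)).indicator (fun r => ENNReal.ofReal (r ^ (-(d : ℝ)))) r =
      (Icc (exp (-R)) (exp R)).indicator (fun r => ENNReal.ofReal r⁻¹) r := by
    intro r
    by_cases hr : r ∈ Icc (exp (-R)) (exp R)
    · have hr0 : 0 < r := (exp_pos _).trans_le hr.1
      rw [indicator_of_mem hr, indicator_of_mem hr, ← ENNReal.ofReal_mul (by positivity),
        ← rpow_natCast r (d - 1), ← rpow_add hr0, ← rpow_neg_one]
      push_cast [hd1]
      congr 2; ring
    · simp [indicator_of_notMem hr]
  simp_rw [h1]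
  have hlt : exp (-R) ≤ exp R := exp_le_exp.2 (by linarith)
  rw [lintegral_indicator measurableSet_Icc, Measure.restrict_restrict measurableSet_Icc,
    inter_eq_left.2 (show Icc (exp (-R)) (exp R) ⊆ Ioi 0 from
      fun r hr => (exp_pos _).trans_le hr.1), ENNReal.ofReal_mul sphereArea_pos.le,
    ← restrict_Ioc_eq_restrict_Icc, ← ofReal_integral_eq_lintegral_ofReal]
  · rw [← intervalIntegral.integral_of_le hlt, integral_inv_of_pos (exp_pos _) (exp_pos _),
      ← exp_sub, log_exp]
    congr 2; ring
  · refine (ContinuousOn.integrableOn_Icc ?_).mono_set Ioc_subset_Icc_self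
    exact continuousOn_inv₀.mono fun r hr => ((exp_pos _).trans_le hr.1).ne'
  · refine (ae_restrict_iff' measurableSet_Ioc).2 (.of_forall fun r hr => ?_)
    have : 0 < r := (exp_pos _).trans hr.1
    positivity

/-- The smooth cut-off on the line used on the logarithmic scale: `1` on `[-1, 1]`, and `0` outside
`(-2, 2)`. -/
noncomputable def logBump : ContDiffBump (0 : ℝ) := ⟨1, 2, one_pos, one_lt_two⟩

lemma logBump_eq_zero {t : ℝ} (ht : 2 ≤ |t|) : logBump t = 0 :=
  logBump.zero_of_le_dist (by simpa [logBump] using ht)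

lemma logBump_eq_one {t : ℝ} (ht : |t| ≤ 1) : logBump t = 1 :=
  logBump.one_of_mem_closedBall (by simpa [logBump] using ht)

lemma exists_lipschitz_logBump : ∃ L : ℝ, ∀ a b, |logBump a - logBump b| ≤ L * |a - b| := by
  have h1 : ContDiff ℝ 1 logBump := logBump.contDiff
  obtain ⟨C, hC⟩ := h1.lipschitzWith_of_hasCompactSupport logBump.hasCompactSupport (by simp)
  exact ⟨C, fun a b => by simpa [Real.dist_eq] using hC.dist_le_mul a b⟩

/-- The ground state cut off on the logarithmic scale `N`. -/
noncomputable def cutoffGroundState (s N : ℝ) (x : 𝔼) : ℂ :=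
  ((groundState s x * logBump (log ‖x‖ / N) : ℝ) : ℂ)

lemma groundState_zero {s : ℝ} (hs : s < (d : ℝ) / 2) : groundState s (0 : 𝔼) = 0 := by
  rw [groundState, norm_zero, zero_rpow (by linarith)]

lemma isTestFunction_cutoffGroundState {s N : ℝ} (hs : s < (d : ℝ) / 2) (hN : 0 < N) :
    IsTestFunction (cutoffGroundState (d := d) s N) := by
  constructor
  · rw [contDiff_iff_contDiffAt]
    intro x
    by_cases hx : x = 0
    · subst hx
      have : cutoffGroundState (d := d) s N =ᶠ[𝓝 0] fun _ => 0 := by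
        filter_upwards [Metric.ball_mem_nhds (0 : 𝔼) (exp_pos (-(2 * N)))] with y hy
        rw [mem_ball_zero_iff] at hy
        by_cases hy0 : y = 0
        -- Since `log 0 = 0` in Lean, the cut-off factor is `1` at the origin; there the ground state
        -- takes the value `0`.
        · simp [cutoffGroundState, hy0, groundState_zero hs]
        · have hpy : 0 < ‖y‖ := norm_pos_iff.2 hy0
          have h1 : log ‖y‖ < -(2 * N) := (log_lt_iff_lt_exp hpy).2 hy
          have h2 : log ‖y‖ / N ≤ -2 := by rw [div_le_iff₀ hN]; linarith
          have h3 : (2 : ℝ) ≤ |log ‖y‖ / N| := le_abs.2 (Or.inr (by linarith))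
          simp [cutoffGroundState, logBump_eq_zero h3]
      exact contDiffAt_const.congr_of_eventuallyEq this
    · have hn : ‖x‖ ≠ 0 := norm_ne_zero_iff.2 hx
      have h1 : ContDiffAt ℝ ∞ (fun x : 𝔼 => ‖x‖) x := contDiffAt_norm ℝ hx
      have h2 : ContDiffAt ℝ ∞ (fun x : 𝔼 => ‖x‖ ^ (-(((d : ℝ) - 2 * s) / 2))) x :=
        h1.rpow_const_of_ne hn
      have h3 : ContDiffAt ℝ ∞ (fun x : 𝔼 => log ‖x‖ / N) x := (h1.log hn).div_const N
      have h4 : ContDiffAt ℝ ∞ (fun x : 𝔼 => logBump (log ‖x‖ / N)) x :=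
        logBump.contDiff.contDiffAt.comp x h3
      exact Complex.ofRealCLM.contDiff.contDiffAt.comp x (h2.mul h4)
  · refine HasCompactSupport.intro (isCompact_closedBall (0 : 𝔼) (exp (2 * N))) fun x hx => ?_
    rw [mem_closedBall_zero_iff, not_le] at hx
    have hpx : 0 < ‖x‖ := (exp_pos _).trans hx
    have h1 : 2 * N < log ‖x‖ := (lt_log_iff_exp_lt hpx).2 hx
    have h2 : 2 ≤ log ‖x‖ / N := by rw [le_div_iff₀ hN]; linarith
    simp [cutoffGroundState, logBump_eq_zero (h2.trans (le_abs_self _))]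

lemma le_lintegral_hardyDensity_cutoffGroundState [NeZero d] {s N : ℝ} (hN : 0 < N) :
    ENNReal.ofReal (sphereArea d * (2 * N)) ≤
      ∫⁻ x : 𝔼, ENNReal.ofReal (hardyDensity s (cutoffGroundState s N) x) := by
  rw [← lintegral_shell hN]
  refine lintegral_mono fun x => ?_
  by_cases hx : ‖x‖ ∈ Icc (exp (-N)) (exp N)
  · have hpx : 0 < ‖x‖ := (exp_pos _).trans_le hx.1
    have h1 : -N ≤ log ‖x‖ := (le_log_iff_exp_le hpx).2 hx.1
    have h2 : log ‖x‖ ≤ N := (log_le_iff_le_exp hpx).2 hx.2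
    have h3 : |log ‖x‖ / N| ≤ 1 := by
      rw [abs_div, abs_of_pos hN, div_le_one hN]
      exact abs_le.2 ⟨h1, h2⟩
    rw [indicator_of_mem hx]
    refine ENNReal.ofReal_le_ofReal (le_of_eq ?_)
    rw [hardyDensity, cutoffGroundState, logBump_eq_one h3, mul_one, Complex.norm_real,
      norm_of_nonneg (groundState_nonneg s x), groundState, ← rpow_natCast (‖x‖ ^ _) 2,
      ← rpow_mul hpx.le, ← rpow_add hpx]
    congr 1
    push_cast; ring
  · simp [indicator_of_notMem hx]

/-- The majorant of the ground state kernel of `cutoffGroundState s N`, where `L` is a Lipschitz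
constant of the cut-off. -/
noncomputable def logKernel (s L N : ℝ) (x y : 𝔼) : ENNReal :=
  ENNReal.ofReal (min 1 ((L * (log ‖x‖ - log ‖y‖) / N) ^ 2) * groundState s x * groundState s y *
    rieszKernel s x y)

@[fun_prop]
lemma measurable_logKernel (s L N : ℝ) :
    Measurable fun p : 𝔼 × 𝔼 => logKernel s L N p.1 p.2 := by
  unfold logKernel; fun_prop

@[fun_prop]
lemma measurable_logKernel_right (s L N : ℝ) (x : 𝔼) : Measurable (logKernel s L N x) := by
  unfold logKernel rieszKernel; fun_prop

lemma logKernel_comm (s L N : ℝ) (x y : 𝔼) : logKernel s L N x y = logKernel s L N y x := by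
  have h : (L * (log ‖x‖ - log ‖y‖) / N) ^ 2 = (L * (log ‖y‖ - log ‖x‖) / N) ^ 2 := by ring
  simp only [logKernel, rieszKernel, norm_sub_rev x y, h]
  congr 1; ring

lemma lintegral_logKernel [NeZero d] {s L N : ℝ} (hs : s < (d : ℝ) / 2) {e x : 𝔼} (he : ‖e‖ = 1)
    (hx : x ≠ 0) : ∫⁻ y, logKernel s L N x y =
      ENNReal.ofReal (‖x‖ ^ (-(d : ℝ))) * ∫⁻ y, logKernel s L N e y := by
  have hh := lintegral_of_homogeneous (d := d) (F := logKernel s L N) (p := -(2 * d)) ?_ ?_ he hx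
  · rw [hh]
    congr 3; ring
  · intro R x y
    simp only [logKernel, groundState, rieszKernel, ← map_sub, LinearIsometryEquiv.norm_map]
  · intro r hr x y
    by_cases hx : x = 0
    · simp [logKernel, hx, groundState_zero hs]
    by_cases hy : y = 0
    · simp [logKernel, hy, groundState_zero hs]
    have hx' : ‖x‖ ≠ 0 := norm_ne_zero_iff.2 hx
    have hy' : ‖y‖ ≠ 0 := norm_ne_zero_iff.2 hy
    simp only [logKernel]
    rw [← ENNReal.ofReal_mul (by positivity)]
    simp only [groundState, rieszKernel, ← smul_sub, norm_smul, norm_of_nonneg hr.le,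
      log_mul hr.ne' hx', log_mul hr.ne' hy', add_sub_add_left_eq_sub,
      mul_rpow hr.le (norm_nonneg _)]
    have : r ^ (-(2 * d : ℝ)) = r ^ (-(((d : ℝ) - 2 * s) / 2)) * r ^ (-(((d : ℝ) - 2 * s) / 2)) *
        r ^ (-((d : ℝ) + 2 * s)) := by
      rw [← rpow_add hr, ← rpow_add hr]; congr 1; ring
    rw [this]
    congr 1; ring

/-- The indicator function of the shell `exp(-2N) ≤ |x| ≤ exp(2N)`, which contains the support of
`cutoffGroundState s N`. -/
noncomputable def shellIndicator (N : ℝ) (x : 𝔼) : ENNReal :=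
  (Icc (exp (-(2 * N))) (exp (2 * N))).indicator (fun _ => 1) ‖x‖

@[fun_prop]
lemma measurable_shellIndicator (N : ℝ) : Measurable (shellIndicator (d := d) N) :=
  (Measurable.indicator measurable_const measurableSet_Icc).comp measurable_norm

lemma shellIndicator_eq_one {N : ℝ} (hN : 0 < N) {x : 𝔼} (hx : x ≠ 0)
    (h : logBump (log ‖x‖ / N) ≠ 0) : shellIndicator N x = 1 := by
  have hpx : 0 < ‖x‖ := norm_pos_iff.2 hx
  have h1 : |log ‖x‖ / N| < 2 := by
    by_contra hn
    exact h (logBump_eq_zero (not_lt.1 hn))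
  rw [abs_div, abs_of_pos hN, div_lt_iff₀ hN, abs_lt] at h1
  have hmem : ‖x‖ ∈ Icc (exp (-(2 * N))) (exp (2 * N)) :=
    ⟨(le_log_iff_exp_le hpx).1 (by linarith), (log_le_iff_le_exp hpx).1 (by linarith)⟩
  exact indicator_of_mem hmem _

lemma groundStateQuotient_cutoffGroundState {s N : ℝ} {x : 𝔼} (hx : x ≠ 0) :
    groundStateQuotient s (cutoffGroundState s N) x = ((logBump (log ‖x‖ / N) : ℝ) : ℂ) := by
  have hpx : 0 < ‖x‖ := norm_pos_iff.2 hx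
  have : 0 < ‖x‖ ^ (((d : ℝ) - 2 * s) / 2) := by positivity
  rw [groundStateQuotient, cutoffGroundState, ← Complex.ofReal_mul, groundState,
    rpow_neg hpx.le, ← mul_assoc, mul_inv_cancel₀ this.ne', one_mul]

/-- The kernel vanishes unless `x` or `y` lies in the shell that contains the support of the
cut-off. -/
lemma groundStateKernel_cutoffGroundState_le {s N L : ℝ} (hN : 0 < N)
    (hL : ∀ a b, |logBump a - logBump b| ≤ L * |a - b|) {x y : 𝔼} (hx : x ≠ 0) (hy : y ≠ 0) :
    ENNReal.ofReal (groundStateKernel s (groundStateQuotient s (cutoffGroundState s N)) x y) ≤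
      shellIndicator N x * logKernel s L N x y + shellIndicator N y * logKernel s L N x y := by
  by_cases hz : logBump (log ‖x‖ / N) = 0 ∧ logBump (log ‖y‖ / N) = 0
  · rw [groundStateKernel, groundStateQuotient_cutoffGroundState hx,
      groundStateQuotient_cutoffGroundState hy, hz.1, hz.2]
    simp
  · have hχ1 : 1 ≤ shellIndicator N x + shellIndicator N y := by
      rcases not_and_or.1 hz with h | h
      · simp [shellIndicator_eq_one hN hx h]
      · simp [shellIndicator_eq_one hN hy h]
    rw [← add_mul]
    refine le_trans ?_ (mul_le_mul_left hχ1 _)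
    rw [one_mul, logKernel]
    refine ENNReal.ofReal_le_ofReal ?_
    rw [groundStateKernel, groundStateQuotient_cutoffGroundState hx,
      groundStateQuotient_cutoffGroundState hy, ← Complex.ofReal_sub, Complex.norm_real,
      norm_eq_abs, div_eq_mul_inv, ← rpow_neg (norm_nonneg (x - y))]
    have hmin : |logBump (log ‖x‖ / N) - logBump (log ‖y‖ / N)| ^ 2 ≤
        min 1 ((L * (log ‖x‖ - log ‖y‖) / N) ^ 2) := by
      refine le_min ?_ ?_
      · have h1 := logBump.nonneg (x := log ‖x‖ / N)
        have h2 := logBump.nonneg (x := log ‖y‖ / N)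
        have h3 := logBump.le_one (x := log ‖x‖ / N)
        have h4 := logBump.le_one (x := log ‖y‖ / N)
        rw [sq_abs]
        nlinarith
      · have h1 := hL (log ‖x‖ / N) (log ‖y‖ / N)
        calc _ ≤ (L * |log ‖x‖ / N - log ‖y‖ / N|) ^ 2 := by gcongr
          _ = _ := by rw [mul_pow, sq_abs]; ring
    have hg1 := groundState_nonneg s x
    have hg2 := groundState_nonneg s y
    have hr := rieszKernel_nonneg s x y
    calc _ = |logBump (log ‖x‖ / N) - logBump (log ‖y‖ / N)| ^ 2 *
          (groundState s x * groundState s y * rieszKernel s x y) := by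
          simp only [groundState, rieszKernel]; ring
      _ ≤ min 1 ((L * (log ‖x‖ - log ‖y‖) / N) ^ 2) *
          (groundState s x * groundState s y * rieszKernel s x y) := by gcongr
      _ = _ := by ring

lemma lintegral_shellIndicator_mul_logKernel [NeZero d] {s N L : ℝ} (hs : s < (d : ℝ) / 2)
    (hN : 0 < N) {e : 𝔼} (he : ‖e‖ = 1) :
    ∫⁻ x : 𝔼, ∫⁻ y : 𝔼, shellIndicator N x * logKernel s L N x y =
      ENNReal.ofReal (sphereArea d * (2 * (2 * N))) * ∫⁻ y, logKernel s L N e y := by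
  have h0 : ∀ᵐ x : 𝔼, x ≠ 0 := by simp [ae_iff]
  have hm : Measurable fun x : 𝔼 => (Icc (exp (-(2 * N))) (exp (2 * N))).indicator
      (fun r => ENNReal.ofReal (r ^ (-(d : ℝ)))) ‖x‖ :=
    (Measurable.indicator (by fun_prop) measurableSet_Icc).comp measurable_norm
  rw [← lintegral_shell (by positivity : 0 < 2 * N), ← lintegral_mul_const _ hm]
  refine lintegral_congr_ae (h0.mono fun x hx => ?_)
  have hχt : shellIndicator N x ≠ ⊤ := by
    simp only [shellIndicator, indicator]; split_ifs <;> simp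
  beta_reduce
  rw [lintegral_const_mul' _ _ hχt, lintegral_logKernel hs he hx, ← mul_assoc]
  congr 1
  simp only [shellIndicator, indicator]
  split_ifs <;> simp

lemma groundStateEnergy_cutoffGroundState_le [NeZero d] {s N L : ℝ} (hs : s < (d : ℝ) / 2)
    (hN : 0 < N) (hL : ∀ a b, |logBump a - logBump b| ≤ L * |a - b|) {e : 𝔼} (he : ‖e‖ = 1) :
    groundStateEnergy s (cutoffGroundState (d := d) s N) ≤
      ENNReal.ofReal (2 * (sphereArea d * (2 * (2 * N)))) * ∫⁻ y, logKernel s L N e y := by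
  have h0 : ∀ᵐ x : 𝔼, x ≠ 0 := by simp [ae_iff]
  have hm1 : Measurable fun p : 𝔼 × 𝔼 => shellIndicator N p.1 * logKernel s L N p.1 p.2 := by
    fun_prop
  have hm2 : Measurable fun p : 𝔼 × 𝔼 => shellIndicator N p.2 * logKernel s L N p.1 p.2 := by
    fun_prop
  have hX := lintegral_shellIndicator_mul_logKernel (d := d) (L := L) hs hN he
  have hY : ∫⁻ x : 𝔼, ∫⁻ y : 𝔼, shellIndicator N y * logKernel s L N x y =
      ∫⁻ x : 𝔼, ∫⁻ y : 𝔼, shellIndicator N x * logKernel s L N x y := by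
    refine (lintegral_lintegral_swap hm2.aemeasurable).trans ?_
    exact lintegral_congr fun x => lintegral_congr fun y => by rw [logKernel_comm]
  calc groundStateEnergy s (cutoffGroundState (d := d) s N)
      ≤ ∫⁻ x : 𝔼, ∫⁻ y : 𝔼, (shellIndicator N x * logKernel s L N x y +
          shellIndicator N y * logKernel s L N x y) := by
        rw [groundStateEnergy]
        refine lintegral_mono_ae (h0.mono fun x hx => ?_)
        exact lintegral_mono_ae (h0.mono fun y hy =>
          groundStateKernel_cutoffGroundState_le hN hL hx hy)
    _ = (∫⁻ x : 𝔼, ∫⁻ y : 𝔼, shellIndicator N x * logKernel s L N x y) +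
          ∫⁻ x : 𝔼, ∫⁻ y : 𝔼, shellIndicator N y * logKernel s L N x y := by
        rw [← lintegral_add_left hm1.lintegral_prod_right']
        refine lintegral_congr fun x => ?_
        exact lintegral_add_left ((measurable_logKernel_right s L N x).const_mul _) _
    _ = _ := by
        rw [hY, hX, ← two_mul, ← mul_assoc, ENNReal.ofReal_mul two_pos.le]
        simp

lemma abs_log_le_two_mul {t : ℝ} (ht : 1 / 2 ≤ t) : |log t| ≤ 2 * |t - 1| := by
  have h0 : 0 < t := by linarith
  have h1 := log_le_sub_one_of_pos h0
  have h2 := one_sub_inv_le_log_of_pos h0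
  have h3 : 1 - t⁻¹ = (t - 1) / t := by field_simp
  rcases le_total t 1 with h | h
  · rw [abs_of_nonpos (log_nonpos h0.le h), abs_of_nonpos (by linarith)]
    have : 2 * (t - 1) ≤ (t - 1) / t := by
      rw [le_div_iff₀ h0]; nlinarith
    linarith
  · rw [abs_of_nonneg (log_nonneg h), abs_of_nonneg (by linarith)]
    linarith

/-- On the diagonal the singularity `|e-y|^(-(d+2s))` is compensated by `log² |y| ≲ |e-y|²`. -/
lemma lintegral_logKernel_lt_top [NeZero d] {s L : ℝ} (hs0 : 0 < s) (hs1 : s < 1)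
    (hs : s < (d : ℝ) / 2) {e : 𝔼} (he : ‖e‖ = 1) : ∫⁻ y, logKernel s L 1 e y < ⊤ := by
  have hd : 0 < (d : ℝ) := by exact_mod_cast Nat.pos_of_ne_zero (NeZero.ne d)
  set α := ((d : ℝ) - 2 * s) / 2 with hα
  have hge : groundState s e = 1 := by simp [groundState, he]
  set c1 : ℝ := 4 * L ^ 2 * 2 ^ α * exp 1 with hc1
  set c2 : ℝ := 5 ^ ((d : ℝ) + 2 * s) with hc2
  have hc1' : 0 ≤ c1 := by positivity
  have hc2' : 0 ≤ c2 := by positivity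
  have hb : ∀ y, logKernel s L 1 e y ≤
      ENNReal.ofReal c1 * ENNReal.ofReal (‖y - e‖ ^ (2 - ((d : ℝ) + 2 * s)) *
        exp (-(1 * ‖y - e‖ ^ 2))) +
      ENNReal.ofReal c2 * ENNReal.ofReal (groundState s y * (1 + ‖y‖) ^ (-((d : ℝ) + 2 * s))) := by
    intro y
    have hg := groundState_nonneg s y
    rw [← ENNReal.ofReal_mul hc1', ← ENNReal.ofReal_mul hc2',
      ← ENNReal.ofReal_add (by positivity) (by positivity), logKernel, hge, mul_one]
    refine ENNReal.ofReal_le_ofReal ?_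
    have hk : rieszKernel s e y = ‖y - e‖ ^ (-((d : ℝ) + 2 * s)) := by
      rw [rieszKernel, norm_sub_rev]
    have hk0 := rieszKernel_nonneg s e y
    have hp1 : 0 ≤ c1 * (‖y - e‖ ^ (2 - ((d : ℝ) + 2 * s)) * exp (-(1 * ‖y - e‖ ^ 2))) := by
      positivity
    have hp2 : 0 ≤ c2 * (groundState s y * (1 + ‖y‖) ^ (-((d : ℝ) + 2 * s))) := by positivity
    have htri : |‖y‖ - 1| ≤ ‖y - e‖ := by rw [← he]; exact abs_norm_sub_norm_le y e
    rcases le_total ‖y - e‖ (1 / 2) with hy | hy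
    · have hy2 : 1 / 2 ≤ ‖y‖ := by linarith [(abs_le.1 htri).1]
      by_cases hye : y - e = 0
      · have : rieszKernel s e y = 0 := by
          rw [hk, hye, norm_zero, zero_rpow (by linarith)]
        rw [this, mul_zero]
        linarith
      have hpos : 0 < ‖y - e‖ := norm_pos_iff.2 hye
      have h1 : min 1 ((L * (log ‖e‖ - log ‖y‖) / 1) ^ 2) ≤ L ^ 2 * (4 * ‖y - e‖ ^ 2) := by
        refine (min_le_right _ _).trans ?_
        have h2 := (abs_log_le_two_mul hy2).trans (mul_le_mul_of_nonneg_left htri two_pos.le)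
        have h3 : log ‖y‖ ^ 2 ≤ 4 * ‖y - e‖ ^ 2 := by
          rw [← sq_abs]
          calc |log ‖y‖| ^ 2 ≤ (2 * ‖y - e‖) ^ 2 := by gcongr
            _ = _ := by ring
        rw [he, log_one, div_one, zero_sub, mul_pow, neg_sq]
        gcongr
      have h2 : groundState s y ≤ 2 ^ α := by
        have := rpow_le_rpow_of_nonpos (by norm_num) hy2 (by linarith : -α ≤ 0)
        rw [one_div, inv_rpow (by norm_num), ← rpow_neg (by norm_num), neg_neg] at this
        exact this
      have h3 : 1 ≤ exp 1 * exp (-(1 * ‖y - e‖ ^ 2)) := by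
        rw [← exp_add]
        exact one_le_exp (by nlinarith)
      have h4 : ‖y - e‖ ^ (2 - ((d : ℝ) + 2 * s)) = ‖y - e‖ ^ 2 * rieszKernel s e y := by
        rw [hk, sub_eq_add_neg 2, rpow_add hpos, rpow_two]
      calc _ ≤ L ^ 2 * (4 * ‖y - e‖ ^ 2) * 2 ^ α * rieszKernel s e y := by gcongr
        _ ≤ L ^ 2 * (4 * ‖y - e‖ ^ 2) * 2 ^ α * rieszKernel s e y *
            (exp 1 * exp (-(1 * ‖y - e‖ ^ 2))) := le_mul_of_one_le_right (by positivity) h3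
        _ = c1 * (‖y - e‖ ^ (2 - ((d : ℝ) + 2 * s)) * exp (-(1 * ‖y - e‖ ^ 2))) := by
            rw [h4, hc1]; ring
        _ ≤ _ := by linarith
    · have h1 : (1 + ‖y‖) / 5 ≤ ‖y - e‖ := by
        have := (abs_le.1 htri).2
        linarith
      have hy0 := norm_nonneg y
      have h2 : rieszKernel s e y ≤ c2 * (1 + ‖y‖) ^ (-((d : ℝ) + 2 * s)) := by
        rw [hk]
        refine (rpow_le_rpow_of_nonpos (by positivity) h1 (by linarith)).trans_eq ?_
        rw [div_rpow (by positivity) (by norm_num), rpow_neg (x := 5) (by norm_num), hc2]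
        field_simp
      calc _ ≤ 1 * groundState s y * (c2 * (1 + ‖y‖) ^ (-((d : ℝ) + 2 * s))) := by
            gcongr
            exact min_le_left _ _
        _ = c2 * (groundState s y * (1 + ‖y‖) ^ (-((d : ℝ) + 2 * s))) := by ring
        _ ≤ _ := by linarith
  refine (lintegral_mono hb).trans_lt ?_
  rw [lintegral_add_left (by fun_prop), lintegral_const_mul' _ _ ENNReal.ofReal_ne_top,
    lintegral_const_mul' _ _ ENNReal.ofReal_ne_top,
    lintegral_sub_right_eq_self (μ := (volume : Measure 𝔼)) (fun z : 𝔼 =>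
      ENNReal.ofReal (‖z‖ ^ (2 - ((d : ℝ) + 2 * s)) * exp (-(1 * ‖z‖ ^ 2)))) e,
    lintegral_rpow_norm_mul_gaussian (by linarith) one_pos]
  exact ENNReal.add_lt_top.2 ⟨ENNReal.mul_lt_top ENNReal.ofReal_lt_top ENNReal.ofReal_lt_top,
    ENNReal.mul_lt_top ENNReal.ofReal_lt_top (lintegral_groundState_mul_one_add_lt_top hs0 hs)⟩

/-- The scale `n = 0` dominates all others. -/
lemma tendsto_lintegral_logKernel [NeZero d] {s L : ℝ} (hs0 : 0 < s) (hs1 : s < 1)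
    (hs : s < (d : ℝ) / 2) {e : 𝔼} (he : ‖e‖ = 1) :
    Tendsto (fun n : ℕ => ∫⁻ y, logKernel s L ((n : ℝ) + 1) e y) atTop (𝓝 0) := by
  have hmain := tendsto_lintegral_of_dominated_convergence (μ := (volume : Measure 𝔼))
    (F := fun (n : ℕ) y => logKernel s L ((n : ℝ) + 1) e y) (f := fun _ => 0)
    (fun y => logKernel s L 1 e y) (fun n => measurable_logKernel_right _ _ _ _)
    (fun n => .of_forall fun y => ?_)
    (lintegral_logKernel_lt_top hs0 hs1 hs he).ne (.of_forall fun y => ?_)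
  · simpa using hmain
  · refine ENNReal.ofReal_le_ofReal ?_
    have h1 : (L * (log ‖e‖ - log ‖y‖) / ((n : ℝ) + 1)) ^ 2 ≤
        (L * (log ‖e‖ - log ‖y‖) / 1) ^ 2 := by
      rw [div_pow, div_pow, one_pow, div_one]
      refine div_le_self (sq_nonneg _) (one_le_pow₀ ?_)
      have : (0 : ℝ) ≤ n := by positivity
      linarith
    have hg1 := groundState_nonneg s e
    have hg2 := groundState_nonneg s y
    have hr := rieszKernel_nonneg s e y
    gcongr
  · have h1 : Tendsto (fun n : ℕ => L * (log ‖e‖ - log ‖y‖) / ((n : ℝ) + 1)) atTop (𝓝 0) :=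
      tendsto_const_nhds.div_atTop
        (tendsto_atTop_add_const_right _ _ tendsto_natCast_atTop_atTop)
    have h2 : Tendsto (fun n : ℕ => min 1 ((L * (log ‖e‖ - log ‖y‖) / ((n : ℝ) + 1)) ^ 2) *
        groundState s e * groundState s y * rieszKernel s e y) atTop (𝓝 0) := by
      have h3 := ((((tendsto_const_nhds (x := (1 : ℝ))).min (h1.pow 2)).mul_const
        (groundState s e)).mul_const (groundState s y)).mul_const (rieszKernel s e y)
      simpa using h3
    have h4 := ENNReal.tendsto_ofReal h2
    simpa [logKernel] using h4

/-! ### The Hardy inequality, its sharpness, and strictness -/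

lemma IsTestFunction.integrable_hardyDensity [NeZero d] {s : ℝ} (hs : s < (d : ℝ) / 2)
    {u : 𝔼 → ℂ} (hu : IsTestFunction u) : Integrable (hardyDensity s u) := by
  have hm := hu.1.continuous.measurable
  refine ⟨Measurable.aestronglyMeasurable (by unfold hardyDensity; fun_prop), ?_⟩
  rw [hasFiniteIntegral_iff_ofReal (.of_forall (hardyDensity_nonneg s u))]
  exact hu.lintegral_hardyDensity_lt_top hs

lemma IsTestFunction.measurable_fourierHat {u : 𝔼 → ℂ} (hu : IsTestFunction u) :
    Measurable (fourierHat u) := by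
  obtain ⟨v, rfl⟩ := hu.exists_schwartz
  obtain ⟨w, hw⟩ := exists_schwartz_eq_fourierHat v
  rw [show fourierHat v = w from funext fun ξ => (hw ξ).symm]
  exact w.continuous.measurable

lemma IsTestFunction.groundState_representation [NeZero d] {s : ℝ} (hs0 : 0 < s) (hs1 : s < 1)
    (hs : s < (d : ℝ) / 2) {u : 𝔼 → ℂ} (hu : IsTestFunction u) :
    groundStateEnergy s u ≠ ⊤ ∧
      (∫ ξ, kineticDensity s (fourierHat u) ξ) - hardyConst s d * ∫ x, hardyDensity s u x =
        formConst s d * (groundStateEnergy s u).toReal :=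
  hu.hasFourierTransform.groundState_representation hs0 hs1 hs hu.1.continuous.measurable
    hu.measurable_fourierHat (hu.integrable_hardyDensity hs)
    (hu.integrable_kineticDensity hs0 hs1)

/-- Equality is not attained. The values of `u` and `g` on null sets are irrelevant, so both may be
taken to be measurable. -/
lemma HasFourierTransform.hardy_strict [NeZero d] {s : ℝ} (hs0 : 0 < s) (hs1 : s < 1)
    (hs : s < (d : ℝ) / 2) {u g : 𝔼 → ℂ} (hug : HasFourierTransform u g)
    (hM : Integrable (hardyDensity s u)) (hT : Integrable (kineticDensity s g))
    (hu0 : ¬ u =ᵐ[volume] 0) :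
    hardyConst s d * ∫ x, hardyDensity s u x < ∫ ξ, kineticDensity s g ξ := by
  obtain ⟨hu, hg, H⟩ := hug
  have hue := hu.ae_eq_mk
  have hge := hg.ae_eq_mk
  set u' := hu.mk u with hu'
  set g' := hg.mk g with hg'
  have hum : Measurable u' := hu.stronglyMeasurable_mk.measurable
  have hgm : Measurable g' := hg.stronglyMeasurable_mk.measurable
  have hMe : hardyDensity s u =ᵐ[volume] hardyDensity s u' := by
    filter_upwards [hue] with x hx
    rw [hardyDensity, hardyDensity, hx]
  have hTe : kineticDensity s g =ᵐ[volume] kineticDensity s g' := by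
    filter_upwards [hge] with x hx
    rw [kineticDensity, kineticDensity, hx]
  have hug' : HasFourierTransform u' g' := by
    refine ⟨hum.aestronglyMeasurable, hgm.aestronglyMeasurable, fun φ => ?_⟩
    obtain ⟨i1, i2, e⟩ := H φ
    have e1 : (fun x => u x * fourierHat φ x) =ᵐ[volume] fun x => u' x * fourierHat φ x := by
      filter_upwards [hue] with x hx
      rw [hx]
    have e2 : (fun x => g x * φ x) =ᵐ[volume] fun x => g' x * φ x := by
      filter_upwards [hge] with x hx
      rw [hx]
    exact ⟨i1.congr e1, i2.congr e2, by rw [← integral_congr_ae e1, ← integral_congr_ae e2, e]⟩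
  have hM' := hM.congr hMe
  obtain ⟨hfin, hrep⟩ := hug'.groundState_representation hs0 hs1 hs hum hgm hM' (hT.congr hTe)
  have hne := groundStateEnergy_ne_zero (s := s) hum
    (ofReal_integral_eq_lintegral_ofReal hM' (.of_forall (hardyDensity_nonneg s u')) ▸
      ENNReal.ofReal_ne_top) (fun h => hu0 (hue.trans h))
  have hpos := mul_pos (formConst_pos (d := d) hs0 hs1) (ENNReal.toReal_pos hne hfin)
  rw [integral_congr_ae hMe, integral_congr_ae hTe]
  linarith

/-- Sharpness: for the logarithmic cut-offs of the ground state, the ground state energy is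
negligible compared with the Hardy integral. -/
lemma inv_hardyConst_le_of_forall [NeZero d] {s : ℝ} (hs0 : 0 < s) (hs1 : s < 1)
    (hs : s < (d : ℝ) / 2) {K : ℝ}
    (hK : ∀ u : 𝔼 → ℂ, IsTestFunction u →
      ∫ x, hardyDensity s u x ≤ K * ∫ ξ, kineticDensity s (fourierHat u) ξ) :
    (hardyConst s d)⁻¹ ≤ K := by
  have hC := hardyConst_pos (d := d) hs0 hs
  have ha := formConst_pos (d := d) hs0 hs1
  have hS := sphereArea_pos (d := d)
  obtain ⟨e, he⟩ : ∃ e : 𝔼, ‖e‖ = 1 := exists_norm_eq 𝔼 zero_le_one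
  obtain ⟨L, hL⟩ := exists_lipschitz_logBump
  set θ : ℕ → ENNReal := fun n => ∫⁻ y, logKernel s L ((n : ℝ) + 1) e y with hθ
  have hθlim : Tendsto θ atTop (𝓝 0) := tendsto_lintegral_logKernel hs0 hs1 hs he
  have hbound : ∀ n : ℕ, θ n ≠ ⊤ →
      1 ≤ K * hardyConst s d + |K| * formConst s d * (4 * (θ n).toReal) := by
    intro n hθn
    have hN : (0 : ℝ) < n + 1 := by positivity
    set N : ℝ := n + 1 with hNdef
    have hu := isTestFunction_cutoffGroundState (d := d) hs hN
    obtain ⟨hfin, hrep⟩ := hu.groundState_representation hs0 hs1 hs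
    have h1 := hK _ hu
    have h2 := le_lintegral_hardyDensity_cutoffGroundState (d := d) (s := s) hN
    rw [← ofReal_integral_eq_lintegral_ofReal (hu.integrable_hardyDensity hs)
      (.of_forall (hardyDensity_nonneg s _)),
      ENNReal.ofReal_le_ofReal_iff (integral_nonneg (hardyDensity_nonneg s _))] at h2
    have h3 := ENNReal.toReal_mono (ENNReal.mul_ne_top ENNReal.ofReal_ne_top hθn)
      (groundStateEnergy_cutoffGroundState_le hs hN hL he)
    rw [ENNReal.toReal_mul, ENNReal.toReal_ofReal (by positivity)] at h3
    change _ ≤ _ * (θ n).toReal at h3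
    set M := ∫ x, hardyDensity s (cutoffGroundState (d := d) s N) x
    set T := ∫ ξ, kineticDensity s (fourierHat (cutoffGroundState (d := d) s N)) ξ
    set G := (groundStateEnergy s (cutoffGroundState (d := d) s N)).toReal
    have hG0 : 0 ≤ G := ENNReal.toReal_nonneg
    have hMpos : 0 < M := lt_of_lt_of_le (by positivity) h2
    -- Two copies of the shell of logarithmic width `4 N` against the width `2 N` in the lower bound
    -- for `M` give the factor `4`.
    have hGM : G ≤ 4 * (θ n).toReal * M := by
      have : 0 ≤ (θ n).toReal := ENNReal.toReal_nonneg
      nlinarith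
    have hT : T = hardyConst s d * M + formConst s d * G := by linarith
    have h4 : K * (formConst s d * G) ≤ |K| * formConst s d * (4 * (θ n).toReal) * M := by
      calc K * (formConst s d * G) ≤ |K| * (formConst s d * (4 * (θ n).toReal * M)) := by
            gcongr
            exact le_abs_self K
        _ = _ := by ring
    have h5 : 1 * M ≤ (K * hardyConst s d + |K| * formConst s d * (4 * (θ n).toReal)) * M := by
      rw [hT] at h1
      linarith
    exact le_of_mul_le_mul_right h5 hMpos
  have hlim : Tendsto (fun n => K * hardyConst s d + |K| * formConst s d * (4 * (θ n).toReal)) atTop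
      (𝓝 (K * hardyConst s d)) := by
    have h1 : Tendsto (fun n => (θ n).toReal) atTop (𝓝 0) := by
      have h := (ENNReal.tendsto_toReal ENNReal.zero_ne_top).comp hθlim
      rw [ENNReal.toReal_zero] at h
      exact h
    simpa using ((h1.const_mul 4).const_mul (|K| * formConst s d)).const_add (K * hardyConst s d)
  have hev : ∀ᶠ n in atTop, θ n ≠ ⊤ :=
    (hθlim.eventually (gt_mem_nhds ENNReal.zero_lt_top)).mono fun n hn => hn.ne
  have h1 : 1 ≤ K * hardyConst s d := ge_of_tendsto hlim (hev.mono hbound)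
  rwa [inv_le_iff_one_le_mul₀ hC]

end FracHardy

/-- For `0 < s < min {1, d/2}`:
(1) the ground state representation of `h_s[u]` for `u ∈ C_0^∞(ℝ^d ∖ {0})`, all integrals being
absolutely convergent;
(2) the Hardy inequality on `C_0^∞(ℝ^d)`, all integrals being finite;
(3) its constant is sharp;
(4) equality is not attained by any nonzero function for which both sides are finite. -/
theorem proposition4p1 (d : ℕ) (s : ℝ) (hs0 : 0 < s) (hs : s < min 1 ((d : ℝ) / 2)) :
    (∀ u : EuclideanSpace ℝ (Fin d) → ℂ, FracHardy.IsTestFunction u → 0 ∉ tsupport u →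
      Integrable (FracHardy.kineticDensity s (FracHardy.fourierHat u)) ∧
      Integrable (FracHardy.hardyDensity s u) ∧
      Integrable (fun p : EuclideanSpace ℝ (Fin d) × EuclideanSpace ℝ (Fin d) =>
        FracHardy.groundStateKernel s (FracHardy.groundStateQuotient s u) p.1 p.2)
        (volume.prod volume) ∧
      FracHardy.hardyForm s u = FracHardy.formConst s d *
        ∫ x, ∫ y, FracHardy.groundStateKernel s (FracHardy.groundStateQuotient s u) x y) ∧
    (∀ u : EuclideanSpace ℝ (Fin d) → ℂ, FracHardy.IsTestFunction u →
      Integrable (FracHardy.kineticDensity s (FracHardy.fourierHat u)) ∧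
      Integrable (FracHardy.hardyDensity s u) ∧
      ∫ x, FracHardy.hardyDensity s u x ≤
        (FracHardy.hardyConst s d)⁻¹ *
          ∫ ξ, FracHardy.kineticDensity s (FracHardy.fourierHat u) ξ) ∧
    (∀ K : ℝ,
      (∀ u : EuclideanSpace ℝ (Fin d) → ℂ, FracHardy.IsTestFunction u →
        ∫ x, FracHardy.hardyDensity s u x ≤
          K * ∫ ξ, FracHardy.kineticDensity s (FracHardy.fourierHat u) ξ) →
      (FracHardy.hardyConst s d)⁻¹ ≤ K) ∧
    (∀ u g : EuclideanSpace ℝ (Fin d) → ℂ, FracHardy.HasFourierTransform u g →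
      Integrable (FracHardy.hardyDensity s u) → Integrable (FracHardy.kineticDensity s g) →
      ¬ (u =ᵐ[volume] 0) →
      ∫ x, FracHardy.hardyDensity s u x <
        (FracHardy.hardyConst s d)⁻¹ * ∫ ξ, FracHardy.kineticDensity s g ξ) := by
  have hs1 : s < 1 := hs.trans_le (min_le_left _ _)
  have hsd : s < (d : ℝ) / 2 := hs.trans_le (min_le_right _ _)
  have hd : NeZero d := ⟨fun h => by
    rw [h] at hsd
    norm_num at hsd
    linarith⟩
  have hC := FracHardy.hardyConst_pos hs0 hsd
  have ha := FracHardy.formConst_pos (d := d) hs0 hs1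
  refine ⟨fun u hu _ => ?_, fun u hu => ?_, fun K hK => ?_, fun u g hug hM hT hu0 => ?_⟩
  · obtain ⟨hfin, hrep⟩ := hu.groundState_representation hs0 hs1 hsd
    obtain ⟨hint, hval⟩ := FracHardy.integrable_groundStateKernel hu.1.continuous.measurable hfin
    refine ⟨hu.integrable_kineticDensity hs0 hs1, hu.integrable_hardyDensity hsd, hint, ?_⟩
    rw [hval, ← hrep, FracHardy.hardyForm]
  · obtain ⟨-, hrep⟩ := hu.groundState_representation hs0 hs1 hsd
    refine ⟨hu.integrable_kineticDensity hs0 hs1, hu.integrable_hardyDensity hsd, ?_⟩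
    rw [le_inv_mul_iff₀ hC]
    have := mul_nonneg ha.le (ENNReal.toReal_nonneg (a := FracHardy.groundStateEnergy s u))
    linarith
  · exact FracHardy.inv_hardyConst_le_of_forall hs0 hs1 hsd hK
  · rw [lt_inv_mul_iff₀ hC]
    exact hug.hardy_strict hs0 hs1 hsd hM hT hu0
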